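/- Let $\mathcal X,\mathcal K$ be real Hilbert spaces, let $\Gamma_0(\mathcal H)$ denote the set of proper lower semicontinuous convex functions $\mathcal H\to(-\infty,\infty]$, and for $h\in\Gamma_0(\mathcal H)$ let $\operatorname{dom}(h)=\{x : h(x)<\infty\}$ and $\operatorname{prox}_h(x)=\operatorname{argmin}_{y}\,\bigl[h(y)+\tfrac12\|y-x\|^2\bigr]$. Let $f\in\Gamma_0(\mathcal X)$, $g\in\Gamma_0(\mathcal K)$, and let $A:\mathcal X\to\mathcal K$ be a bounded linear operator with adjoint $A^*$. Assume that $\mathcal S_p:=\operatorname{argmin}_{x\in\mathcal X}[f(x)+g(Ax)]\neq\varnothing$ and that $0\in\operatorname{sri}(\operatorname{dom}(g)-A\operatorname{dom}(f))$, where $\operatorname{sri}(C)=\{x\in C : \{t(y-x) : t>0,\ y\in C\}=\overline{\operatorname{span}}(C-x)\}$. Let $\check A:\mathcal X\times\mathcal K\to\mathcal K$, $(x,y)\mapsto Ax-y$ (products carry the Hilbert product norm), and let $\mathfrak u>0$ satisfy $\|\check A\|_{\rm op}\le 1/\mathfrak u$. Let $\Psi\in\Gamma_0(\mathcal X)$ be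 real-valued and Gâteaux differentiable on $\mathcal X$ with Lipschitz continuous gradient $\nabla\Psi$, and assume $\Omega:=\operatorname{argmin}_{x\in\mathcal S_p}\Psi(x)\neq\varnothing$. On $\mathcal H:=\mathcal X\times\mathcal K\times\mathcal K$ define $\mathbf T_{\rm LAL}(x,y,\nu)=(x_T,y_T,\nu_T)$ by $$x_T=\operatorname{prox}_f\bigl(x-\mathfrak u^2(A^*Ax-A^*y)+\mathfrak uA^*\nu\bigr),\quad y_T=\operatorname{prox}_g\bigl(y-\mathfrak u^2(-Ax+y)-\mathfrak u\nu\bigr),\quad \nu_T=\nu-\mathfrak u(Ax_T-y_T),$$ and let $\Xi:\mathcal H\to\mathcal X$, $(x,y,\nu)\mapsto x$, and $\Theta:=\Psi\circ\Xi$. Then $\mathbf T_{\rm LAL}$ can be plugged into the hybrid steepest descent method, in the following sense. (1) $\operatorname{prox}_f$ and $\operatorname{prox}_g$ are well defined (each defining minimization problem has exactly one minimizer), $\mathbf T_{\rm LAL}$ is nonexpansive, and $\Theta\in\Gamma_0(\mathcal H)$ is Gâteaux differentiable with Lipschitz continuous gradient $\nabla\Theta=\Xi^*\circ\nabla\Psi\circ\Xi$.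 (2) For every $\alpha\in(0,1)$ the operator $T_\alpha:=(1-\alpha)I+\alpha\mathbf T_{\rm LAL}$ is an attracting nonexpansive operator, i.e. it is nonexpansive, $\operatorname{Fix}(T_\alpha)\neq\varnothing$, and $\|T_\alpha w-z\|<\|w-z\|$ for all $w\notin\operatorname{Fix}(T_\alpha)$ and $z\in\operatorname{Fix}(T_\alpha)$. Moreover $\operatorname{Fix}(T_\alpha)=\operatorname{Fix}(\mathbf T_{\rm LAL})$, $\mathcal S_p=\Xi(\operatorname{Fix}(T_\alpha))$, $\Omega_{\rm LAL}:=\operatorname{argmin}_{w\in\operatorname{Fix}(T_\alpha)}\Theta(w)\neq\varnothing$, and $\Omega=\Xi(\Omega_{\rm LAL})$. (3) For every $\alpha\in(0,1)$, every nonnegative sequence $(\lambda_{n+1})_{n\in\mathbb N}$ with $\sum_n\lambda_{n+1}^2<\infty$ and $\sum_n\lambda_{n+1}=\infty$, and every $(x_0^\star,y_0,\nu_0)\in\mathcal H$, the sequence generated by $$(x_{n+1/2},y_{n+1},\nu_{n+1})=(1-\alpha)(x_n^\star,y_n,\nu_n)+\alpha\,\mathbf T_{\rm LAL}(x_n^\star,y_n,\nu_n),\qquad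 x_{n+1}^\star=x_{n+1/2}-\lambda_{n+1}\nabla\Psi(x_{n+1/2})$$ is the hybrid steepest descent sequence $w_{n+1}=T_\alpha(w_n)-\lambda_{n+1}\nabla\Theta(T_\alpha(w_n))$, $w_0=(x_0^\star,y_0,\nu_0)$, with $w_n=(x_n^\star,y_n,\nu_n)$. If in addition $\dim\mathcal H<\infty$ and $\operatorname{Fix}(\mathbf T_{\rm LAL})$ is bounded, then $$\lim_{n\to\infty}d_\Omega(x_n^\star)=0,\qquad d_\Omega(x):=\inf_{y\in\Omega}\|x-y\|.$$ -/

import Mathlib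

noncomputable section

namespace LALHSDM

/-! ### Convex analysis -/

section Convex

variable {E : Type*} [NormedAddCommGroup E] [InnerProductSpace ℝ E]

/-- Effective domain of an extended-real-valued function. -/
def effDom (f : E → EReal) : Set E := {x | f x < ⊤}

/-- The class `Γ₀(E)` of proper lower semicontinuous convex functions `E → (-∞, ∞]`. -/
structure IsGamma0 (f : E → EReal) : Prop where
  ne_bot : ∀ x, f x ≠ ⊥
  proper : (effDom f).Nonempty
  lsc : LowerSemicontinuous f
  convex : ∀ x ∈ effDom f, ∀ y ∈ effDom f, ∀ t : ℝ, 0 < t → t < 1 →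
    f (t • x + (1 - t) • y) ≤ (t : EReal) * f x + ((1 - t : ℝ) : EReal) * f y

/-- The set of minimizers of `F` over the set `S`. -/
def argminOn {α β : Type*} [LE β] (F : α → β) (S : Set α) : Set α :=
  {x | x ∈ S ∧ ∀ y ∈ S, F x ≤ F y}

/-- `p` minimizes `f y + ‖y - x‖² / 2` over all `y`. -/
def IsProx (f : E → EReal) (x p : E) : Prop :=
  p ∈ argminOn (fun y => f y + ((‖y - x‖ ^ 2 / 2 : ℝ) : EReal)) Set.univ

/-- The proximity operator: `prox f x` is the minimizer of `f y + ‖y - x‖² / 2`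
(for `f ∈ Γ₀(E)` on a Hilbert space, it exists and is unique). -/
def prox (f : E → EReal) (x : E) : E := Classical.epsilon (IsProx f x)

/-- The conical hull `{t • x | t > 0, x ∈ C}`. -/
def coneHull (C : Set E) : Set E := {z | ∃ t : ℝ, 0 < t ∧ ∃ x ∈ C, z = t • x}

/-- The strong relative interior: the points `x ∈ C` such that the conical hull of `C - x`
is the closed linear span of `C - x`. -/
def sri (C : Set E) : Set E :=
  {x | x ∈ C ∧ coneHull ((fun y => y - x) '' C) =
    closure (Submodule.span ℝ ((fun y => y - x) '' C) : Set E)}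

/-- `a` is the Gâteaux gradient of `F` at `x`. -/
def HasGateauxGradientAt (F : E → ℝ) (a x : E) : Prop :=
  ∀ h : E, HasLineDerivAt ℝ F (inner ℝ a h) x h

end Convex

/-! ### Nonexpansive operators and the hybrid steepest descent method -/

section Operators

variable {E : Type*} [NormedAddCommGroup E] [InnerProductSpace ℝ E]

/-- `T` is nonexpansive. -/
def Nonexpansive (T : E → E) : Prop := ∀ x y, ‖T x - T y‖ ≤ ‖x - y‖

/-- `T` is an attracting nonexpansive operator (with nonempty fixed point set). -/
structure IsAttracting (T : E → E) : Prop where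
  nonexpansive : Nonexpansive T
  fix_nonempty : (Function.fixedPoints T).Nonempty
  attracting : ∀ x ∉ Function.fixedPoints T, ∀ z ∈ Function.fixedPoints T,
    ‖T x - z‖ < ‖x - z‖

/-- The relaxed operator `(1 - α) I + α T`. -/
def relax (α : ℝ) (T : E → E) (x : E) : E := (1 - α) • x + α • T x

/-- The hybrid steepest descent sequence for the operator `T` and the gradient field `G`:
`x (n+1) = T (x n) - lam (n+1) • G (T (x n))`. -/
def hsdmSeq (T G : E → E) (lam : ℕ → ℝ) (x₀ : E) : ℕ → E
  | 0 => x₀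
  | n + 1 => T (hsdmSeq T G lam x₀ n) - lam (n + 1) • G (T (hsdmSeq T G lam x₀ n))

end Operators

/-- The sequence is nonnegative, square-summable and not summable. -/
def IsL2NotL1 (a : ℕ → ℝ) : Prop :=
  (∀ n, 0 ≤ a n) ∧ Summable (fun n => a n ^ 2) ∧ ¬ Summable a

/-! ### The LAL operator -/

section LAL

variable {X K : Type*} [NormedAddCommGroup X] [InnerProductSpace ℝ X] [CompleteSpace X]
  [NormedAddCommGroup K] [InnerProductSpace ℝ K] [CompleteSpace K]

/-- The product Hilbert space `X × K × K`, with elements `(x, y, ν)`. -/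
abbrev Triple (X K : Type*) : Type _ := WithLp 2 (WithLp 2 (X × K) × K)

/-- The triple `(x, y, ν)`. -/
def triple (x : X) (y ν : K) : Triple X K := WithLp.toLp 2 (WithLp.toLp 2 (x, y), ν)

/-- The first component `x` of `w = (x, y, ν)`. -/
def xOf (w : Triple X K) : X := w.fst.fst

/-- The second component `y` of `w = (x, y, ν)`. -/
def yOf (w : Triple X K) : K := w.fst.snd

/-- The third component `ν` of `w = (x, y, ν)`. -/
def nuOf (w : Triple X K) : K := w.snd

/-- The bounded linear operator `(x, y) ↦ A x - y` on the product Hilbert space `X × K`. -/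
def checkA (A : X →L[ℝ] K) : WithLp 2 (X × K) →L[ℝ] K :=
  A ∘L WithLp.fstL 2 ℝ X K - WithLp.sndL 2 ℝ X K

/-- The bounded linear operator `(x, y, ν) ↦ x`. -/
def Xi (X K : Type*) [NormedAddCommGroup X] [InnerProductSpace ℝ X]
    [NormedAddCommGroup K] [InnerProductSpace ℝ K] : Triple X K →L[ℝ] X :=
  WithLp.fstL 2 ℝ X K ∘L WithLp.fstL 2 ℝ (WithLp 2 (X × K)) K

/-- The solution set of the first-stage problem: minimize `f x + g (A x)`. -/
def primalSol (f : X → EReal) (g : K → EReal) (A : X →L[ℝ] K) : Set X :=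
  argminOn (fun x => f x + g (A x)) Set.univ

/-- The solution set of the hierarchical problem: minimize `Ψ` over `primalSol f g A`. -/
def hierSol (f : X → EReal) (g : K → EReal) (A : X →L[ℝ] K) (Ψ : X → ℝ) : Set X :=
  argminOn Ψ (primalSol f g A)

/-- The qualification condition `0 ∈ sri (dom g - A (dom f))`. -/
def Qualified (f : X → EReal) (g : K → EReal) (A : X →L[ℝ] K) : Prop :=
  (0 : K) ∈ sri {z : K | ∃ y ∈ effDom g, ∃ x ∈ effDom f, z = y - A x}

/-- The first component of the LAL operator. -/
def lalX (f : X → EReal) (A : X →L[ℝ] K) (u : ℝ) (x : X) (y ν : K) : X :=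
  prox f (x - u ^ 2 • (A.adjoint (A x) - A.adjoint y) + u • A.adjoint ν)

/-- The second component of the LAL operator. -/
def lalY (g : K → EReal) (A : X →L[ℝ] K) (u : ℝ) (x : X) (y ν : K) : K :=
  prox g (y - u ^ 2 • (-(A x) + y) - u • ν)

/-- The third component of the LAL operator. -/
def lalNu (f : X → EReal) (g : K → EReal) (A : X →L[ℝ] K) (u : ℝ) (x : X) (y ν : K) : K :=
  ν - u • (A (lalX f A u x y ν) - lalY g A u x y ν)

/-- The LAL operator on `X × K × K`. -/
def lalOp (f : X → EReal) (g : K → EReal) (A : X →L[ℝ] K) (u : ℝ) (w : Triple X K) :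
    Triple X K :=
  triple (lalX f A u (xOf w) (yOf w) (nuOf w)) (lalY g A u (xOf w) (yOf w) (nuOf w))
    (lalNu f g A u (xOf w) (yOf w) (nuOf w))

/-- The sequence `(x n, y n, ν n)` generated from `w₀` by the algorithm
`(x (n+1/2), y (n+1), ν (n+1)) = (1 - α) (x n, y n, ν n) + α T (x n, y n, ν n)`,
`x (n+1) = x (n+1/2) - lam (n+1) • ∇Ψ (x (n+1/2))`, with `T` the LAL operator. -/
def lalSeq (f : X → EReal) (g : K → EReal) (A : X →L[ℝ] K) (u : ℝ) (gradΨ : X → X)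
    (α : ℝ) (lam : ℕ → ℝ) (w₀ : Triple X K) : ℕ → Triple X K
  | 0 => w₀
  | n + 1 =>
    let w := lalSeq f g A u gradΨ α lam w₀ n
    let half := (1 - α) • w + α • lalOp f g A u w
    triple (xOf half - lam (n + 1) • gradΨ (xOf half)) (yOf half) (nuOf half)

end LAL

end LALHSDM

end

noncomputable section

namespace LALHSDM

open Filter Topology Set Function

/-! ### Convex functions, subgradients and proximal points in Hilbert space -/

section Convex

variable {E : Type*} [NormedAddCommGroup E] [InnerProductSpace ℝ E]

/-! A fixed point `(x, y, ν)` of the LAL operator is exactly a Karush-Kuhn-Tucker point: the `ν`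
update forces `A x = y`, and the two proximal steps say that `u A* ν` and `-u ν` are subgradients of
`f` at `x` and of `g` at `y` (`mem_fixedPoints_lalOp_iff`). The qualification condition gives every
primal solution a multiplier (`Qualified.exists_lagrange_multiplier`, by Baire category and a
separating hyperplane), so the fixed points project onto the primal solutions, and minimizing `Ψ`
over these amounts to minimizing `Ψ ∘ Ξ` over fixed points. Nonexpansiveness combines monotonicity
of subgradients with the bound on `checkA A` (`norm_sq_le_of_inner_nonneg`).

For convergence, bounded iterates come first: far from a bounded fixed point set one relaxed step
shortens the distance to a fixed point by a constant, which absorbs the drift of the gradient step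
up to a factor `1 + κ² λ²` with summable excess (`exists_norm_hsdmSeq_sub_le`). On the resulting
compact ball, while the distance to the minimizers is at least `ε`, either the displacement or the
gap in `Θ` is bounded below, so the squared distance drops by a multiple of `λ`; since `λ` is not
summable this cannot last (`eventually_le_of_descent`). Finally `Ξ` is 1-Lipschitz.

The nested intersection property below plays the role of weak compactness throughout the
infinite-dimensional part. -/

theorem exists_mem_iInter_of_antitone_convex [CompleteSpace E] {S : ℕ → Set E}
    (hanti : Antitone S) (hne : ∀ n, (S n).Nonempty) (hcl : ∀ n, IsClosed (S n))
    (hconv : ∀ n, Convex ℝ (S n)) (hbdd : Bornology.IsBounded (S 0)) :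
    ∃ x, ∀ n, x ∈ S n := by
  -- The points of least norm have increasing bounded norms; midpoints stay in the larger set, so
  -- the parallelogram law makes them Cauchy.
  have hmin : ∀ n, ∃ v ∈ S n, ∀ w ∈ S n, ‖v‖ ≤ ‖w‖ := by
    intro n
    obtain ⟨v, hv, h⟩ := exists_norm_eq_iInf_of_complete_convex (hne n)
      (hcl n).isComplete (hconv n) 0
    refine ⟨v, hv, fun w hw => ?_⟩
    have hbd : BddBelow (range fun w : S n => ‖(0 : E) - w‖) :=
      ⟨0, by rintro _ ⟨w, rfl⟩; exact norm_nonneg _⟩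
    have := ciInf_le hbd ⟨w, hw⟩
    rw [← h] at this
    simpa using this
  choose v hv hvmin using hmin
  have hmono : Monotone fun n => ‖v n‖ ^ 2 := by
    intro n m hnm
    have := hvmin n (v m) (hanti hnm (hv m))
    dsimp only
    gcongr
  have hbd : BddAbove (range fun n => ‖v n‖ ^ 2) := by
    obtain ⟨C, hC⟩ := hbdd.exists_norm_le
    refine ⟨C ^ 2, ?_⟩
    rintro _ ⟨n, rfl⟩
    have := hC (v n) (hanti (Nat.zero_le n) (hv n))
    dsimp only
    gcongr
  have hlim := tendsto_atTop_ciSup hmono hbd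
  set L := ⨆ n, ‖v n‖ ^ 2 with hL
  have hcauchy : CauchySeq v := by
    apply cauchySeq_of_le_tendsto_0' (fun n => √(2 * (L - ‖v n‖ ^ 2)))
    · intro n m hnm
      have hmid : (1 / 2 : ℝ) • v n + (1 / 2 : ℝ) • v m ∈ S n :=
        hconv n (hv n) (hanti hnm (hv m)) (by norm_num) (by norm_num) (by norm_num)
      have h1 := hvmin n _ hmid
      rw [← smul_add, norm_smul, Real.norm_of_nonneg (by norm_num)] at h1
      have h2 := parallelogram_law_with_norm ℝ (v n) (v m)
      have h3 : ‖v m‖ ^ 2 ≤ L := le_ciSup hbd m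
      rw [dist_eq_norm]
      apply Real.le_sqrt_of_sq_le
      have h4 : (2 * ‖v n‖) ^ 2 ≤ ‖v n + v m‖ ^ 2 := by
        gcongr
        linarith
      nlinarith
    · have : Tendsto (fun n => √(2 * (L - ‖v n‖ ^ 2))) atTop (𝓝 √(2 * (L - L))) :=
        ((tendsto_const_nhds.sub hlim).const_mul 2).sqrt
      simpa using this
  obtain ⟨x, hx⟩ := cauchySeq_tendsto_of_complete hcauchy
  exact ⟨x, fun n => (hcl n).mem_of_tendsto hx
    ((eventually_ge_atTop n).mono fun m hm => hanti hm (hv m))⟩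

namespace IsGamma0

variable {f : E → EReal}

theorem coe_toReal (hf : IsGamma0 f) {x : E} (hx : x ∈ effDom f) :
    (((f x).toReal : ℝ) : EReal) = f x :=
  EReal.coe_toReal (ne_of_lt hx) (hf.ne_bot x)

theorem le_coe_iff (hf : IsGamma0 f) {x : E} {c : ℝ} :
    f x ≤ c ↔ x ∈ effDom f ∧ (f x).toReal ≤ c := by
  constructor
  · intro h
    have hx : x ∈ effDom f := lt_of_le_of_lt h (EReal.coe_lt_top c)
    refine ⟨hx, ?_⟩
    rwa [← hf.coe_toReal hx, EReal.coe_le_coe_iff] at h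
  · rintro ⟨hx, h⟩
    rwa [← hf.coe_toReal hx, EReal.coe_le_coe_iff]

theorem le_of_mem_effDom (hf : IsGamma0 f) {x y : E} (hx : x ∈ effDom f) (hy : y ∈ effDom f)
    {t : ℝ} (h0 : 0 < t) (h1 : t < 1) :
    f (t • x + (1 - t) • y) ≤ ((t * (f x).toReal + (1 - t) * (f y).toReal : ℝ) : EReal) := by
  have h := hf.convex x hx y hy t h0 h1
  rwa [← hf.coe_toReal hx, ← hf.coe_toReal hy, ← EReal.coe_mul, ← EReal.coe_mul,
    ← EReal.coe_add] at h

theorem convexOn (hf : IsGamma0 f) : ConvexOn ℝ (effDom f) fun x => (f x).toReal := by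
  have key : ∀ x ∈ effDom f, ∀ y ∈ effDom f, ∀ a b : ℝ, 0 ≤ a → 0 ≤ b → a + b = 1 →
      a • x + b • y ∈ effDom f ∧
        (f (a • x + b • y)).toReal ≤ a * (f x).toReal + b * (f y).toReal := by
    intro x hx y hy a b ha hb hab
    obtain rfl : b = 1 - a := by linarith
    rcases ha.eq_or_lt with rfl | ha
    · simpa using hy
    rcases hb.eq_or_lt with hb | hb
    · obtain rfl : a = 1 := by linarith
      simpa using hx
    exact hf.le_coe_iff.1 (hf.le_of_mem_effDom hx hy ha (by linarith))
  exact ⟨fun x hx y hy a b ha hb hab => (key x hx y hy a b ha hb hab).1,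
    fun x hx y hy a b ha hb hab => (key x hx y hy a b ha hb hab).2⟩

theorem convex_sublevel (hf : IsGamma0 f) (c : ℝ) : Convex ℝ {x | f x ≤ c} := by
  have := hf.convexOn.convex_le c
  convert this using 1
  ext x
  exact hf.le_coe_iff

theorem isClosed_sublevel (hf : IsGamma0 f) (c : ℝ) : IsClosed {x | f x ≤ c} :=
  hf.lsc.isClosed_preimage c

/-- Otherwise the sublevel sets at `-n`, cut with the ball, would share a point, where `f` would be
`⊥`. -/
theorem exists_le_of_mem_closedBall [CompleteSpace E] (hf : IsGamma0 f) (x₀ : E) (R : ℝ) :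
    ∃ M : ℝ, ∀ y ∈ Metric.closedBall x₀ R, y ∈ effDom f → M ≤ (f y).toReal := by
  by_contra! hcon
  obtain ⟨x, hx⟩ := exists_mem_iInter_of_antitone_convex
    (S := fun n : ℕ => Metric.closedBall x₀ R ∩ {y | f y ≤ ((-(n : ℝ) : ℝ) : EReal)})
    (by
      intro n m hnm x hx
      refine ⟨hx.1, le_trans hx.2 (EReal.coe_le_coe_iff.2 ?_)⟩
      have : (n : ℝ) ≤ m := by exact_mod_cast hnm
      linarith)
    (fun n => by
      obtain ⟨y, hy, hyd, hlt⟩ := hcon (-(n : ℝ))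
      exact ⟨y, hy, hf.le_coe_iff.2 ⟨hyd, hlt.le⟩⟩)
    (fun n => Metric.isClosed_closedBall.inter (hf.isClosed_sublevel _))
    (fun n => (convex_closedBall x₀ R).inter (hf.convex_sublevel _))
    (Metric.isBounded_closedBall.subset inter_subset_left)
  obtain ⟨n, hn⟩ := exists_nat_gt (-(f x).toReal)
  have := (hf.le_coe_iff.1 (hx n).2).2
  linarith

/-- A bound on the unit ball about a point of the domain extrapolates outwards along rays by
convexity. -/
theorem exists_linear_lower_bound [CompleteSpace E] (hf : IsGamma0 f) :
    ∃ a b : ℝ, 0 ≤ b ∧ ∀ y ∈ effDom f, -(a + b * ‖y‖) ≤ (f y).toReal := by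
  obtain ⟨x₀, hx₀⟩ := hf.proper
  obtain ⟨M, hM⟩ := hf.exists_le_of_mem_closedBall x₀ 1
  set c := (f x₀).toReal with hc
  refine ⟨|M| + |c| + (|M| + |c|) * ‖x₀‖, |M| + |c|, by positivity, fun y hy => ?_⟩
  have hr : ‖y - x₀‖ ≤ ‖y‖ + ‖x₀‖ := norm_sub_le _ _
  have hMc : 0 ≤ |M| + |c| := by positivity
  have hprod := mul_le_mul_of_nonneg_left hr hMc
  suffices h : -(|M| + |c|) * (1 + ‖y - x₀‖) ≤ (f y).toReal by nlinarith
  have hM1 := neg_abs_le M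
  have hc1 := le_abs_self c
  have hc2 := abs_nonneg c
  have hM2 := abs_nonneg M
  rcases le_or_gt ‖y - x₀‖ 1 with h1 | h1
  · have := hM y (by simpa [dist_eq_norm] using h1) hy
    nlinarith [norm_nonneg (y - x₀)]
  · set r := ‖y - x₀‖ with hrdef
    have hr0 : 0 < r := by linarith
    have hrinv : r⁻¹ < 1 := inv_lt_one_of_one_lt₀ h1
    have h := hf.le_coe_iff.1 (hf.le_of_mem_effDom hy hx₀ (inv_pos.2 hr0) hrinv)
    have hball : r⁻¹ • y + (1 - r⁻¹) • x₀ ∈ Metric.closedBall x₀ 1 := by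
      have : r⁻¹ • y + (1 - r⁻¹) • x₀ - x₀ = r⁻¹ • (y - x₀) := by module
      rw [Metric.mem_closedBall, dist_eq_norm, this, norm_smul, norm_inv, norm_norm,
        inv_mul_cancel₀ hr0.ne']
    have h2 := (hM _ hball h.1).trans h.2
    have h3 : M * r ≤ (f y).toReal + (r - 1) * c := by
      have := mul_le_mul_of_nonneg_right h2 hr0.le
      calc M * r ≤ _ := this
        _ = (f y).toReal + (r - 1) * c := by field_simp; ring
    nlinarith

end IsGamma0

/-- `a` is a subgradient of `f` at `p`, stated with real values on the effective domain. -/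
def IsSubgradientAt (f : E → EReal) (a p : E) : Prop :=
  p ∈ effDom f ∧ ∀ y ∈ effDom f, (f p).toReal + inner ℝ a (y - p) ≤ (f y).toReal

theorem IsSubgradientAt.inner_nonneg {f : E → EReal} {a b p q : E} (hp : IsSubgradientAt f a p)
    (hq : IsSubgradientAt f b q) : 0 ≤ inner ℝ (a - b) (p - q) := by
  have h1 := hp.2 q hq.1
  have h2 := hq.2 p hp.1
  have h3 : inner ℝ a (q - p) = -inner ℝ a (p - q) := by rw [← inner_neg_right, neg_sub]
  rw [inner_sub_left]
  linarith

theorem IsGamma0.add_coe_le_coe_iff {f : E → EReal} (hf : IsGamma0 f) {x : E} {r c : ℝ} :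
    f x + r ≤ c ↔ x ∈ effDom f ∧ (f x).toReal + r ≤ c := by
  rw [← EReal.le_sub_iff_add_le (by simp) (by simp), ← EReal.coe_sub, hf.le_coe_iff]
  constructor <;> rintro ⟨h1, h2⟩ <;> exact ⟨h1, by linarith⟩

theorem IsGamma0.isProx_iff {f : E → EReal} (hf : IsGamma0 f) {x p : E} :
    IsProx f x p ↔ p ∈ effDom f ∧ ∀ y ∈ effDom f,
      (f p).toReal + ‖p - x‖ ^ 2 / 2 ≤ (f y).toReal + ‖y - x‖ ^ 2 / 2 := by
  have hcoe : ∀ y ∈ effDom f, f y + ((‖y - x‖ ^ 2 / 2 : ℝ) : EReal) =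
      (((f y).toReal + ‖y - x‖ ^ 2 / 2 : ℝ) : EReal) := by
    intro y hy
    rw [EReal.coe_add, hf.coe_toReal hy]
  constructor
  · rintro ⟨-, h⟩
    have key : ∀ y ∈ effDom f, p ∈ effDom f ∧
        (f p).toReal + ‖p - x‖ ^ 2 / 2 ≤ (f y).toReal + ‖y - x‖ ^ 2 / 2 := by
      intro y hy
      have := h y (mem_univ y)
      dsimp only at this
      rw [hcoe y hy] at this
      exact hf.add_coe_le_coe_iff.1 this
    obtain ⟨x₀, hx₀⟩ := hf.proper
    exact ⟨(key x₀ hx₀).1, fun y hy => (key y hy).2⟩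
  · rintro ⟨hp, h⟩
    refine ⟨mem_univ p, fun y _ => ?_⟩
    dsimp only
    by_cases hy : y ∈ effDom f
    · rw [hcoe y hy, hcoe p hp]
      exact EReal.coe_le_coe_iff.2 (h y hy)
    · have : f y = ⊤ := not_lt_top_iff.1 hy
      rw [this, EReal.top_add_coe]
      exact le_top

theorem IsGamma0.isProx_iff_isSubgradientAt {f : E → EReal} (hf : IsGamma0 f) {x p : E} :
    IsProx f x p ↔ IsSubgradientAt f (x - p) p := by
  rw [hf.isProx_iff]
  have hexp : ∀ y, ‖y - x‖ ^ 2 = ‖p - x‖ ^ 2 - 2 * inner ℝ (x - p) (y - p) + ‖y - p‖ ^ 2 := by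
    intro y
    have : y - x = (y - p) - (x - p) := by abel
    rw [this, norm_sub_sq_real, real_inner_comm, norm_sub_rev p x]
    ring
  constructor
  · rintro ⟨hp, h⟩
    refine ⟨hp, fun y hy => ?_⟩
    by_contra! hlt
    set δ := (f p).toReal + inner ℝ (x - p) (y - p) - (f y).toReal with hδ
    have hδ0 : 0 < δ := by linarith
    set s := ‖y - p‖ ^ 2 with hs
    have hs0 : 0 ≤ s := by positivity
    -- Moving from `p` towards `y` by `t` gains `t δ` and costs only `t² s / 2`, so a small `t`
    -- contradicts minimality.
    obtain ⟨t, ht0, ht1, hts⟩ : ∃ t : ℝ, 0 < t ∧ t < 1 ∧ t * s < 2 * δ := by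
      refine ⟨min (1 / 2) (δ / (s + 1)), by positivity, ?_, ?_⟩
      · exact (min_le_left _ _).trans_lt (by norm_num)
      · calc _ ≤ δ / (s + 1) * s := by gcongr; exact min_le_right _ _
          _ ≤ δ := by rw [div_mul_eq_mul_div, div_le_iff₀ (by linarith)]; nlinarith
          _ < 2 * δ := by linarith
    have hc := hf.le_coe_iff.1 (hf.le_of_mem_effDom hy hp ht0 ht1)
    have h1 := h _ hc.1
    have h2 : t • y + (1 - t) • p - p = t • (y - p) := by module
    rw [hexp (t • y + (1 - t) • p), h2, inner_smul_right, norm_smul, mul_pow,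
      Real.norm_of_nonneg ht0.le, ← hs] at h1
    have h3 : t * δ ≤ t * (t * s / 2) := by
      have := hc.2
      rw [hδ]
      nlinarith
    have := le_of_mul_le_mul_left h3 ht0
    linarith
  · rintro ⟨hp, h⟩
    refine ⟨hp, fun y hy => ?_⟩
    have h1 := h y hy
    rw [hexp y]
    nlinarith [sq_nonneg ‖y - p‖]

theorem IsGamma0.isProx_unique {f : E → EReal} (hf : IsGamma0 f) {x p q : E}
    (hp : IsProx f x p) (hq : IsProx f x q) : p = q := by
  rw [hf.isProx_iff_isSubgradientAt] at hp hq
  have h := hp.inner_nonneg hq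
  have h2 : x - p - (x - q) = -(p - q) := by abel
  rw [h2, inner_neg_left, real_inner_self_eq_norm_sq] at h
  have h3 : ‖p - q‖ = 0 := by nlinarith [norm_nonneg (p - q)]
  exact sub_eq_zero.1 (norm_eq_zero.1 h3)

/-- Strong convexity of the quadratic term makes a minimizing sequence Cauchy; lower semicontinuity
handles the limit. -/
theorem IsGamma0.exists_isProx [CompleteSpace E] {f : E → EReal} (hf : IsGamma0 f) (x : E) :
    ∃ p, IsProx f x p := by
  set φ : E → ℝ := fun y => (f y).toReal + ‖y - x‖ ^ 2 / 2 with hφ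
  have hbdd : BddBelow (φ '' effDom f) := by
    obtain ⟨a, b, hb, hab⟩ := hf.exists_linear_lower_bound
    -- Complete the square in `‖y - x‖`.
    refine ⟨-a - b * ‖x‖ - b ^ 2 / 2, ?_⟩
    rintro _ ⟨y, hy, rfl⟩
    have h1 := hab y hy
    have h2 : ‖y‖ ≤ ‖y - x‖ + ‖x‖ := by simpa using norm_add_le (y - x) x
    have h3 := mul_le_mul_of_nonneg_left h2 hb
    simp only [hφ]
    nlinarith [sq_nonneg (‖y - x‖ - b)]
  have hne : (φ '' effDom f).Nonempty := hf.proper.image φ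
  set m := sInf (φ '' effDom f) with hm
  have hmle : ∀ y ∈ effDom f, m ≤ φ y := fun y hy => csInf_le hbdd ⟨y, hy, rfl⟩
  have hex : ∀ n : ℕ, ∃ y ∈ effDom f, φ y < m + 1 / ((n : ℝ) + 1) := by
    intro n
    obtain ⟨_, ⟨y, hy, rfl⟩, h⟩ := exists_lt_of_csInf_lt hne
      (lt_add_of_pos_right m (Nat.one_div_pos_of_nat (α := ℝ) (n := n)))
    exact ⟨y, hy, h⟩
  choose y hy hlt using hex
  have hinv := tendsto_one_div_add_atTop_nhds_zero_nat (𝕜 := ℝ)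
  have hcauchy : CauchySeq y := by
    -- At a midpoint `φ` lies below the average of its end values by at least `‖y n - y k‖² / 8`.
    apply cauchySeq_of_le_tendsto_0' (fun n : ℕ => √(8 * (1 / ((n : ℝ) + 1))))
    · intro n k hnk
      have hk : 1 / ((k : ℝ) + 1) ≤ 1 / ((n : ℝ) + 1) := by gcongr
      have hc := hf.le_coe_iff.1
        (hf.le_of_mem_effDom (hy n) (hy k) (t := 1 / 2) (by norm_num) (by norm_num))
      have h1 := hmle _ hc.1
      have h2 := parallelogram_law_with_norm ℝ (y n - x) (y k - x)
      have h3 : (1 / 2 : ℝ) • y n + (1 - 1 / 2 : ℝ) • y k - x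
          = (1 / 2 : ℝ) • (y n - x + (y k - x)) := by module
      have h4 : y n - x - (y k - x) = y n - y k := by abel
      rw [h4] at h2
      simp only [hφ] at h1 hlt
      rw [h3, norm_smul, mul_pow, Real.norm_of_nonneg (by norm_num)] at h1
      have := hlt n
      have := hlt k
      rw [dist_eq_norm]
      apply Real.le_sqrt_of_sq_le
      nlinarith [hc.2]
    · have := (hinv.const_mul 8).sqrt
      simpa using this
  obtain ⟨p, hp⟩ := cauchySeq_tendsto_of_complete hcauchy
  have hlim : ∀ n : ℕ, f p ≤ ((m + 1 / ((n : ℝ) + 1) - ‖p - x‖ ^ 2 / 2 : ℝ) : EReal) := by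
    intro n
    have hcl : IsClosed {z : E | f z ≤ ((m + 1 / ((n : ℝ) + 1) - ‖z - x‖ ^ 2 / 2 : ℝ) : EReal)} :=
      hf.lsc.isClosed_epigraph.preimage (f := fun z : E =>
        (z, ((m + 1 / ((n : ℝ) + 1) - ‖z - x‖ ^ 2 / 2 : ℝ) : EReal)))
        (continuous_id.prodMk (continuous_coe_real_ereal.comp (by fun_prop)))
    refine hcl.mem_of_tendsto hp ((eventually_ge_atTop n).mono fun k hk => ?_)
    have h1 : 1 / ((k : ℝ) + 1) ≤ 1 / ((n : ℝ) + 1) := by gcongr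
    have h2 := hlt k
    simp only [hφ] at h2
    exact hf.le_coe_iff.2 ⟨hy k, by linarith⟩
  have hpd : p ∈ effDom f := (hf.le_coe_iff.1 (hlim 0)).1
  refine ⟨p, hf.isProx_iff.2 ⟨hpd, fun z hz => (?_ : φ p ≤ φ z)⟩⟩
  refine le_trans ?_ (hmle z hz)
  have h1 : Tendsto (fun n : ℕ => m + 1 / ((n : ℝ) + 1)) atTop (𝓝 (m + 0)) := hinv.const_add m
  rw [add_zero] at h1
  refine ge_of_tendsto' h1 fun n => ?_
  have := (hf.le_coe_iff.1 (hlim n)).2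
  simp only [hφ]
  linarith

theorem IsGamma0.isProx_prox [CompleteSpace E] {f : E → EReal} (hf : IsGamma0 f) (x : E) :
    IsProx f x (prox f x) :=
  Classical.epsilon_spec (hf.exists_isProx x)

theorem IsGamma0.prox_eq_iff [CompleteSpace E] {f : E → EReal} (hf : IsGamma0 f) {x p : E} :
    prox f x = p ↔ IsSubgradientAt f (x - p) p := by
  rw [← hf.isProx_iff_isSubgradientAt]
  exact ⟨fun h => h ▸ hf.isProx_prox x, fun h => hf.isProx_unique (hf.isProx_prox x) h⟩

end Convex

/-! ### Lagrange duality under the qualification condition -/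

section Duality

/-- The points of `D` sent within `1 / (n + 1)` of a limit `s` form nested closed convex bounded
sets; a common point is a preimage of `s`. -/
theorem isClosed_image_of_convex_of_isBounded {E F : Type*} [NormedAddCommGroup E]
    [InnerProductSpace ℝ E] [CompleteSpace E] [NormedAddCommGroup F] [NormedSpace ℝ F]
    (L : E →L[ℝ] F) {D : Set E} (hcl : IsClosed D) (hconv : Convex ℝ D)
    (hbdd : Bornology.IsBounded D) : IsClosed (L '' D) := by
  refine isClosed_of_closure_subset fun s hs => ?_
  obtain ⟨x, hx⟩ := exists_mem_iInter_of_antitone_convex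
    (S := fun n : ℕ => D ∩ L ⁻¹' Metric.closedBall s (1 / ((n : ℝ) + 1)))
    (by
      intro n m hnm x hx
      have h1 : 1 / ((m : ℝ) + 1) ≤ 1 / ((n : ℝ) + 1) := by gcongr
      exact ⟨hx.1, Metric.closedBall_subset_closedBall h1 hx.2⟩)
    (fun n => by
      obtain ⟨_, ⟨x, hx, rfl⟩, h⟩ := Metric.mem_closure_iff.1 hs _
        (Nat.one_div_pos_of_nat (α := ℝ) (n := n))
      exact ⟨x, hx, by simpa [dist_comm] using h.le⟩)
    (fun n => hcl.inter (Metric.isClosed_closedBall.preimage L.continuous))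
    (fun n => hconv.inter ((convex_closedBall s _).linear_preimage L.toLinearMap))
    (hbdd.subset inter_subset_left)
  refine ⟨x, (hx 0).1, ?_⟩
  have h1 : dist (L x) s ≤ 0 :=
    ge_of_tendsto' (tendsto_one_div_add_atTop_nhds_zero_nat (𝕜 := ℝ)) fun n => (hx n).2
  exact dist_le_zero.1 h1

theorem eq_top_of_notMem_effDom {E : Type*} {f : E → EReal} {x : E} (hx : x ∉ effDom f) :
    f x = ⊤ :=
  not_lt_top_iff.1 hx

variable {X K : Type*} [NormedAddCommGroup X] [InnerProductSpace ℝ X]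
  [NormedAddCommGroup K] [InnerProductSpace ℝ K]

/-- The set `dom g - A (dom f)`. -/
def domDiff (f : X → EReal) (g : K → EReal) (A : X →L[ℝ] K) : Set K :=
  {z : K | ∃ y ∈ effDom g, ∃ x ∈ effDom f, z = y - A x}

/-- The closed linear span of `dom g - A (dom f)`. -/
def domDiffSpan (f : X → EReal) (g : K → EReal) (A : X →L[ℝ] K) : Submodule ℝ K :=
  (Submodule.span ℝ (domDiff f g A)).topologicalClosure

variable {f : X → EReal} {g : K → EReal} {A : X →L[ℝ] K}

theorem domDiff_subset_domDiffSpan : domDiff f g A ⊆ domDiffSpan f g A :=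
  Submodule.subset_span.trans (Submodule.le_topologicalClosure _)

theorem Qualified.coneHull_eq (hq : Qualified f g A) :
    coneHull (domDiff f g A) = domDiffSpan f g A := by
  have h := hq.2
  simp only [sub_zero, image_id'] at h
  exact h

theorem Qualified.exists_feasible (hq : Qualified f g A) :
    ∃ x ∈ effDom f, A x ∈ effDom g := by
  obtain ⟨y, hy, x, hx, h⟩ := hq.1
  exact ⟨x, hx, by rwa [← sub_eq_zero.1 h.symm]⟩

/-- The set of `y - A x` with `f x`, `g y` and the norm of `(x, y)` at most `n`. -/
def boundedDiff (f : X → EReal) (g : K → EReal) (A : X →L[ℝ] K) (n : ℕ) : Set K :=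
  (-checkA A) '' ({z | f z.fst ≤ (n : ℝ)} ∩ {z | g z.snd ≤ (n : ℝ)} ∩
    Metric.closedBall (0 : WithLp 2 (X × K)) n)

theorem neg_checkA_apply (A : X →L[ℝ] K) (z : WithLp 2 (X × K)) :
    (-checkA A) z = z.snd - A z.fst := by
  simp [checkA]

theorem convex_boundedDiff_aux (hf : IsGamma0 f) (hg : IsGamma0 g) (n : ℕ) :
    Convex ℝ ({z | f z.fst ≤ (n : ℝ)} ∩ {z | g z.snd ≤ (n : ℝ)} ∩
      Metric.closedBall (0 : WithLp 2 (X × K)) n) :=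
  (((hf.convex_sublevel n).linear_preimage (WithLp.fstL 2 ℝ X K).toLinearMap).inter
    ((hg.convex_sublevel n).linear_preimage (WithLp.sndL 2 ℝ X K).toLinearMap)).inter
    (convex_closedBall _ _)

theorem convex_boundedDiff (hf : IsGamma0 f) (hg : IsGamma0 g) (n : ℕ) :
    Convex ℝ (boundedDiff f g A n) :=
  (convex_boundedDiff_aux hf hg n).linear_image (-checkA A).toLinearMap

theorem boundedDiff_mono : Monotone (boundedDiff f g A) := by
  intro n m hnm
  have h : (n : ℝ) ≤ m := by exact_mod_cast hnm
  refine image_mono (inter_subset_inter (inter_subset_inter ?_ ?_) ?_)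
  · exact fun z hz => le_trans hz (EReal.coe_le_coe_iff.2 h)
  · exact fun z hz => le_trans hz (EReal.coe_le_coe_iff.2 h)
  · exact Metric.closedBall_subset_closedBall h

theorem exists_mem_boundedDiff (hf : IsGamma0 f) (hg : IsGamma0 g) {c : K}
    (hc : c ∈ domDiff f g A) : ∃ n, c ∈ boundedDiff f g A n := by
  obtain ⟨y, hy, x, hx, rfl⟩ := hc
  obtain ⟨n, hn⟩ := exists_nat_ge
    (max (max (f x).toReal (g y).toReal) ‖(WithLp.toLp 2 (x, y) : WithLp 2 (X × K))‖)
  refine ⟨n, WithLp.toLp 2 (x, y), ⟨⟨?_, ?_⟩, ?_⟩, neg_checkA_apply _ _⟩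
  · exact hf.le_coe_iff.2 ⟨hx, ((le_max_left _ _).trans (le_max_left _ _)).trans hn⟩
  · exact hg.le_coe_iff.2 ⟨hy, ((le_max_right _ _).trans (le_max_left _ _)).trans hn⟩
  · exact mem_closedBall_zero_iff.2 ((le_max_right _ _).trans hn)

theorem mem_primalSol_iff (hf : IsGamma0 f) (hg : IsGamma0 g)
    (hfeas : ∃ x ∈ effDom f, A x ∈ effDom g) {p : X} :
    p ∈ primalSol f g A ↔ p ∈ effDom f ∧ A p ∈ effDom g ∧ ∀ x ∈ effDom f, A x ∈ effDom g →
      (f p).toReal + (g (A p)).toReal ≤ (f x).toReal + (g (A x)).toReal := by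
  have hcoe : ∀ x ∈ effDom f, A x ∈ effDom g → f x + g (A x) =
      (((f x).toReal + (g (A x)).toReal : ℝ) : EReal) := by
    intro x hx hgx
    rw [EReal.coe_add, hf.coe_toReal hx, hg.coe_toReal hgx]
  constructor
  · rintro ⟨-, h⟩
    obtain ⟨x₀, hx₀, hgx₀⟩ := hfeas
    have h0 := h x₀ (mem_univ _)
    dsimp only at h0
    rw [hcoe x₀ hx₀ hgx₀] at h0
    have hlt := h0.trans_lt (EReal.coe_lt_top _)
    have hp : p ∈ effDom f := by
      by_contra hn
      rw [eq_top_of_notMem_effDom hn, EReal.top_add_of_ne_bot (hg.ne_bot _)] at hlt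
      exact lt_irrefl _ hlt
    have hgp : A p ∈ effDom g := by
      by_contra hn
      rw [eq_top_of_notMem_effDom hn, EReal.add_top_of_ne_bot (hf.ne_bot _)] at hlt
      exact lt_irrefl _ hlt
    refine ⟨hp, hgp, fun x hx hgx => ?_⟩
    have h1 := h x (mem_univ _)
    dsimp only at h1
    rwa [hcoe x hx hgx, hcoe p hp hgp, EReal.coe_le_coe_iff] at h1
  · rintro ⟨hp, hgp, h⟩
    refine ⟨mem_univ _, fun x _ => ?_⟩
    dsimp only
    by_cases hx : x ∈ effDom f
    · by_cases hgx : A x ∈ effDom g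
      · rw [hcoe x hx hgx, hcoe p hp hgp]
        exact EReal.coe_le_coe_iff.2 (h x hx hgx)
      · rw [eq_top_of_notMem_effDom hgx, EReal.add_top_of_ne_bot (hf.ne_bot _)]
        exact le_top
    · rw [eq_top_of_notMem_effDom hx, EReal.top_add_of_ne_bot (hg.ne_bot _)]
      exact le_top

variable [CompleteSpace X] [CompleteSpace K]

instance : CompleteSpace (domDiffSpan f g A) :=
  (Submodule.isClosed_topologicalClosure _).completeSpace_coe

theorem isClosed_boundedDiff (hf : IsGamma0 f) (hg : IsGamma0 g) (n : ℕ) :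
    IsClosed (boundedDiff f g A n) :=
  isClosed_image_of_convex_of_isBounded _
    ((((hf.isClosed_sublevel n).preimage (WithLp.fstL 2 ℝ X K).continuous).inter
      ((hg.isClosed_sublevel n).preimage (WithLp.sndL 2 ℝ X K).continuous)).inter
      Metric.isClosed_closedBall)
    (convex_boundedDiff_aux hf hg n)
    (Metric.isBounded_closedBall.subset inter_subset_right)

/-- Baire's theorem in the closed span, which the cone hull fills: it is a countable union of closed
dilates of `boundedDiff`, so one of them has interior. -/
theorem Qualified.exists_bounded_preimage (hq : Qualified f g A) (hf : IsGamma0 f)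
    (hg : IsGamma0 g) : ∃ r > 0, ∃ M : ℝ, ∀ v ∈ domDiffSpan f g A, ‖v‖ < r →
      ∃ x y, f x ≤ M ∧ g y ≤ M ∧ y - A x = v := by
  set V := domDiffSpan f g A with hV
  obtain ⟨n₀, hn₀⟩ := exists_mem_boundedDiff hf hg hq.1
  let W : ℕ → Set V := fun n => {v | ((n : ℝ) + 1)⁻¹ • (v : K) ∈ boundedDiff f g A n}
  have hWcl : ∀ n, IsClosed (W n) := fun n =>
    (isClosed_boundedDiff hf hg n).preimage (by fun_prop)
  have hWun : ⋃ n, W n = univ := by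
    refine eq_univ_of_forall fun v => mem_iUnion.2 ?_
    have hv : (v : K) ∈ coneHull (domDiff f g A) := by
      rw [hq.coneHull_eq]; exact v.2
    obtain ⟨t, ht, c, hc, hvc⟩ := hv
    obtain ⟨n₁, hn₁⟩ := exists_mem_boundedDiff hf hg hc
    obtain ⟨n₂, hn₂⟩ := exists_nat_ge t
    set n := max n₀ (max n₁ n₂) with hn
    -- As `0` lies in the convex set `boundedDiff f g A n`, shrinking `c` by the factor `t / (n + 1)
    -- ≤ 1` stays inside.
    refine ⟨n, ?_⟩
    have h0 := boundedDiff_mono (le_max_left _ _ : n₀ ≤ n) hn₀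
    have h1 := boundedDiff_mono ((le_max_left _ _).trans (le_max_right _ _) : n₁ ≤ n) hn₁
    have h2 : (n₂ : ℝ) ≤ n := by
      exact_mod_cast ((le_max_right _ _).trans (le_max_right _ _) : n₂ ≤ n)
    have hpos : (0 : ℝ) < (n : ℝ) + 1 := by positivity
    have h3 : ((n : ℝ) + 1)⁻¹ * t ≤ 1 := by
      rw [inv_mul_le_iff₀ hpos]; linarith
    have h4 := convex_boundedDiff hf hg n h1 h0 (a := ((n : ℝ) + 1)⁻¹ * t)
      (b := 1 - ((n : ℝ) + 1)⁻¹ * t) (by positivity) (by linarith) (by ring)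
    rwa [smul_zero, add_zero, mul_smul, ← hvc] at h4
  obtain ⟨n, v₀, hv₀⟩ := nonempty_interior_of_iUnion_of_closed hWcl hWun
  obtain ⟨r, hr, hball⟩ := Metric.mem_nhds_iff.1 (mem_interior_iff_mem_nhds.1 hv₀)
  -- The ball found is centred at `v₀`. Writing `-v₀` as `t` times a domain difference recentres it
  -- at `0`; `ρ` normalizes the weights `n + 1` and `t`.
  have hneg : -(v₀ : K) ∈ coneHull (domDiff f g A) := by
    rw [hq.coneHull_eq]; exact neg_mem v₀.2
  obtain ⟨t, ht, _, ⟨y₁, hy₁, x₁, hx₁, rfl⟩, hv₀c⟩ := hneg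
  set ρ : ℝ := (n + 1 + t)⁻¹ with hρ
  have hρ0 : 0 < ρ := by positivity
  have hsum : (n + 1) * ρ + t * ρ = 1 := by rw [← add_mul, hρ, mul_inv_cancel₀ (by positivity)]
  set M := max (n : ℝ) (max (f x₁).toReal (g y₁).toReal) with hM
  have hMn : ((n : ℝ) : EReal) ≤ M := EReal.coe_le_coe_iff.2 (le_max_left _ _)
  refine ⟨ρ * r, by positivity, M, fun v hv hvr => ?_⟩
  set v' : V := ⟨ρ⁻¹ • v, V.smul_mem _ hv⟩ with hv'
  have hmem : v₀ + v' ∈ W n := by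
    apply hball
    rw [Metric.mem_ball, dist_eq_norm, add_sub_cancel_left, hv', Submodule.coe_norm, norm_smul,
      norm_inv, Real.norm_of_nonneg hρ0.le, inv_mul_lt_iff₀ hρ0]
    exact hvr
  obtain ⟨z, ⟨⟨hzf, hzg⟩, -⟩, hz⟩ := hmem
  rw [neg_checkA_apply] at hz
  refine ⟨((n + 1) * ρ) • z.fst + (t * ρ) • x₁, ((n + 1) * ρ) • z.snd + (t * ρ) • y₁,
    ?_, ?_, ?_⟩
  · exact hf.convex_sublevel M (le_trans hzf hMn)
      (hf.le_coe_iff.2 ⟨hx₁, (le_max_left _ _).trans (le_max_right _ _)⟩)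
      (by positivity) (by positivity) hsum
  · exact hg.convex_sublevel M (le_trans hzg hMn)
      (hg.le_coe_iff.2 ⟨hy₁, (le_max_right _ _).trans (le_max_right _ _)⟩)
      (by positivity) (by positivity) hsum
  · have h1 : (v₀ : K) + ρ⁻¹ • v = ((n : ℝ) + 1) • (z.snd - A z.fst) := by
      rw [hz, smul_inv_smul₀ (by positivity)]; rfl
    have h2 : v = ρ • (((n : ℝ) + 1) • (z.snd - A z.fst) + t • (y₁ - A x₁)) := by
      rw [← h1, ← hv₀c]
      rw [add_right_comm, add_neg_cancel, zero_add, smul_inv_smul₀ hρ0.ne']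
    rw [h2, map_add, map_smul, map_smul]
    module

/-- A dual solution, from a supporting hyperplane to the epigraph of the value function. -/
theorem Qualified.exists_lagrange_multiplier (hq : Qualified f g A) (hf : IsGamma0 f)
    (hg : IsGamma0 g) {p : X} (hp : p ∈ primalSol f g A) :
    ∃ φ : K, ∀ x ∈ effDom f, ∀ y ∈ effDom g,
      (f p).toReal + (g (A p)).toReal + inner ℝ φ (y - A x) ≤ (f x).toReal + (g y).toReal := by
  obtain ⟨hpf, hpg, hmin⟩ := (mem_primalSol_iff hf hg hq.exists_feasible).1 hp
  obtain ⟨r, hr, M, hM⟩ := hq.exists_bounded_preimage hf hg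
  set V := domDiffSpan f g A with hV
  set m := (f p).toReal + (g (A p)).toReal with hm
  -- Working over `V` rather than `K` lets this set have interior even when the domain differences
  -- span a proper subspace.
  let Q : Set (V × ℝ) := {q | ∃ x ∈ effDom f, ∃ y ∈ effDom g, y - A x = (q.1 : K) ∧
    (f x).toReal + (g y).toReal ≤ q.2}
  have hQconv : Convex ℝ Q := by
    rintro q ⟨x, hx, y, hy, hq1, hq2⟩ q' ⟨x', hx', y', hy', hq1', hq2'⟩ a b ha hb hab
    refine ⟨a • x + b • x', hf.convexOn.1 hx hx' ha hb hab,
      a • y + b • y', hg.convexOn.1 hy hy' ha hb hab, ?_, ?_⟩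
    · simp only [Prod.fst_add, Prod.smul_fst, Submodule.coe_add, Submodule.coe_smul, ← hq1, ← hq1',
        map_add, map_smul]
      module
    · have h1 := hf.convexOn.2 hx hx' ha hb hab
      have h2 := hg.convexOn.2 hy hy' ha hb hab
      simp only [smul_eq_mul] at h1 h2
      simp only [Prod.snd_add, Prod.smul_snd, smul_eq_mul]
      nlinarith [mul_le_mul_of_nonneg_left hq2 ha, mul_le_mul_of_nonneg_left hq2' hb]
  have hsub : Metric.ball (0 : V) r ×ˢ Ioi (2 * M) ⊆ interior Q := by
    refine interior_maximal ?_ (Metric.isOpen_ball.prod isOpen_Ioi)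
    rintro ⟨v, s⟩ ⟨hv, hs⟩
    obtain ⟨x, y, hx, hy, hxy⟩ := hM v v.2 (by simpa using hv)
    obtain ⟨hx, hx'⟩ := hf.le_coe_iff.1 hx
    obtain ⟨hy, hy'⟩ := hg.le_coe_iff.1 hy
    exact ⟨x, hx, y, hy, hxy, by have : 2 * M < s := hs; dsimp only; linarith⟩
  have hlow : ∀ s, ((0 : V), s) ∈ Q → m ≤ s := by
    rintro s ⟨x, hx, y, hy, hxy, hs⟩
    have hy' : y = A x := sub_eq_zero.1 (by simpa using hxy)
    subst hy'
    exact (hmin x hx hy).trans hs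
  have hnot : ((0 : V), m) ∉ interior Q := by
    intro h
    have hcont : Continuous fun s : ℝ => ((0 : V), s) := by fun_prop
    have hnhds : ∀ᶠ s in 𝓝 m, ((0 : V), s) ∈ Q :=
      hcont.continuousAt.eventually (mem_interior_iff_mem_nhds.1 h)
    obtain ⟨ε, hε, hball⟩ := Metric.eventually_nhds_iff.1 hnhds
    have := hlow (m - ε / 2) (hball (by
      rw [Real.dist_eq, sub_sub_cancel_left, abs_neg, abs_of_pos (by linarith)]; linarith))
    linarith
  obtain ⟨ℓ, hℓ⟩ := geometric_hahn_banach_open_point hQconv.interior isOpen_interior hnot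
  set ψ : StrongDual ℝ V := ℓ.comp (ContinuousLinearMap.inl ℝ V ℝ) with hψ
  set β := ℓ (0, 1) with hβ
  have hsplit : ∀ v s, ℓ (v, s) = ψ v + s * β := by
    intro v s
    have : (v, s) = (v, (0 : ℝ)) + s • ((0 : V), (1 : ℝ)) := by simp
    rw [this, map_add, map_smul]
    rfl
  set s₁ := max (2 * M) m + 1 with hs₁
  have hs₁M : 2 * M < s₁ := (le_max_left _ _).trans_lt (lt_add_one _)
  have hs₁m : m < s₁ := (le_max_right _ _).trans_lt (lt_add_one _)
  have hmem₁ : ((0 : V), s₁) ∈ interior Q := hsub ⟨Metric.mem_ball_self hr, hs₁M⟩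
  -- The hyperplane is not vertical: an interior point lies straight above `(0, m)`.
  have hβ0 : β < 0 := by
    have := hℓ _ hmem₁
    rw [hsplit, hsplit] at this
    nlinarith
  have hle : ∀ q ∈ Q, ℓ q ≤ ℓ (0, m) := by
    intro q hq
    have hcl : q ∈ closure (interior Q) := by
      rw [hQconv.closure_interior_eq_closure_of_nonempty_interior ⟨_, hmem₁⟩]
      exact subset_closure hq
    exact closure_minimal (fun a ha => (hℓ a ha).le)
      (isClosed_le ℓ.continuous continuous_const) hcl
  set a : V := (InnerProductSpace.toDual ℝ V).symm ψ with ha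
  refine ⟨(-β)⁻¹ • (a : K), fun x hx y hy => ?_⟩
  have hv : y - A x ∈ V := domDiff_subset_domDiffSpan ⟨y, hy, x, hx, rfl⟩
  have h1 := hle (⟨y - A x, hv⟩, (f x).toReal + (g y).toReal) ⟨x, hx, y, hy, rfl, le_rfl⟩
  rw [hsplit, hsplit, map_zero, zero_add] at h1
  have h2 : ψ ⟨y - A x, hv⟩ = inner ℝ (a : K) (y - A x) := by
    rw [← InnerProductSpace.toDual_symm_apply (x := (⟨y - A x, hv⟩ : V)), ← ha]
    rfl
  rw [h2] at h1
  rw [real_inner_smul_left]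
  have h3 : (-β)⁻¹ * inner ℝ (a : K) (y - A x) ≤ (f x).toReal + (g y).toReal - m := by
    rw [inv_mul_le_iff₀ (by linarith)]
    linarith
  linarith

/-- The Karush-Kuhn-Tucker description of the solutions of the first-stage problem. -/
theorem Qualified.mem_primalSol_iff_exists (hq : Qualified f g A) (hf : IsGamma0 f)
    (hg : IsGamma0 g) {p : X} : p ∈ primalSol f g A ↔
      ∃ φ : K, IsSubgradientAt f (-A.adjoint φ) p ∧ IsSubgradientAt g φ (A p) := by
  rw [mem_primalSol_iff hf hg hq.exists_feasible]
  constructor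
  · intro h
    obtain ⟨φ, hφ⟩ := hq.exists_lagrange_multiplier hf hg
      ((mem_primalSol_iff hf hg hq.exists_feasible).2 h)
    -- The multiplier inequality splits by fixing `y = A p` for `f` and `x = p` for `g`.
    refine ⟨φ, ⟨h.1, fun x hx => ?_⟩, h.2.1, fun y hy => ?_⟩
    · have := hφ x hx (A p) h.2.1
      rw [← map_sub, ← ContinuousLinearMap.adjoint_inner_left, ← neg_sub, inner_neg_right] at this
      rw [inner_neg_left]
      linarith
    · have := hφ p h.1 y hy
      linarith
  · rintro ⟨φ, h1, h2⟩
    refine ⟨h1.1, h2.1, fun x hx hgx => ?_⟩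
    have h3 := h1.2 x hx
    have h4 := h2.2 (A x) hgx
    rw [inner_neg_left, ContinuousLinearMap.adjoint_inner_left, map_sub] at h3
    linarith

end Duality

/-! ### Nonexpansive operators and their relaxations -/

theorem Nonexpansive.continuous {E : Type*} [NormedAddCommGroup E] {T : E → E}
    (hT : Nonexpansive T) : Continuous T :=
  (LipschitzWith.of_dist_le_mul (K := 1) fun x y => by
    simpa [dist_eq_norm] using hT x y).continuous

section Relax

variable {E : Type*} [NormedAddCommGroup E] [InnerProductSpace ℝ E] {T : E → E} {α : ℝ}

theorem relax_sub (α : ℝ) (T : E → E) (w z : E) :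
    relax α T w - z = (w - z) - α • (w - T w) := by
  unfold relax; module

theorem fixedPoints_relax (hα : α ≠ 0) (T : E → E) :
    fixedPoints (relax α T) = fixedPoints T := by
  ext w
  rw [mem_fixedPoints_iff, mem_fixedPoints_iff, ← sub_eq_zero, relax_sub, sub_self, zero_sub,
    neg_eq_zero, smul_eq_zero_iff_right hα, sub_eq_zero, eq_comm]

/-- Cocoercivity of `I - T`, obtained by expanding `‖T w - T w'‖² ≤ ‖w - w'‖²`. -/
theorem Nonexpansive.sq_norm_le_inner (hT : Nonexpansive T) (w w' : E) :
    ‖(w - T w) - (w' - T w')‖ ^ 2 ≤ 2 * inner ℝ ((w - T w) - (w' - T w')) (w - w') := by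
  have h1 : ‖T w - T w'‖ ^ 2 ≤ ‖w - w'‖ ^ 2 := by gcongr; exact hT w w'
  have h2 : T w - T w' = (w - w') - ((w - T w) - (w' - T w')) := by abel
  rw [h2, norm_sub_sq_real, real_inner_comm] at h1
  linarith

theorem Nonexpansive.sq_norm_le_inner_of_mem (hT : Nonexpansive T) (w : E) {z : E}
    (hz : z ∈ fixedPoints T) : ‖w - T w‖ ^ 2 ≤ 2 * inner ℝ (w - T w) (w - z) := by
  have h := hT.sq_norm_le_inner w z
  rwa [mem_fixedPoints_iff.1 hz, sub_self, sub_zero] at h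

theorem Nonexpansive.relax (hT : Nonexpansive T) (h0 : 0 ≤ α) (h1 : α ≤ 1) :
    Nonexpansive (relax α T) := by
  intro x y
  have h : LALHSDM.relax α T x - LALHSDM.relax α T y =
      (1 - α) • (x - y) + α • (T x - T y) := by
    unfold LALHSDM.relax; module
  rw [h]
  calc _ ≤ ‖(1 - α) • (x - y)‖ + ‖α • (T x - T y)‖ := norm_add_le _ _
    _ = (1 - α) * ‖x - y‖ + α * ‖T x - T y‖ := by
      rw [norm_smul, norm_smul, Real.norm_of_nonneg h0, Real.norm_of_nonneg (by linarith)]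
    _ ≤ ‖x - y‖ := by nlinarith [hT x y]

/-- Keeping the inner product, which grows linearly far from the fixed points, is what later bounds
the iterates. -/
theorem Nonexpansive.sq_norm_relax_sub_le_inner (hT : Nonexpansive T) (w : E) {z : E}
    (hz : z ∈ fixedPoints T) : ‖LALHSDM.relax α T w - z‖ ^ 2 ≤
      ‖w - z‖ ^ 2 - 2 * (α * (1 - α)) * inner ℝ (w - T w) (w - z) := by
  have h := hT.sq_norm_le_inner_of_mem w hz
  rw [relax_sub, norm_sub_sq_real, inner_smul_right, norm_smul, mul_pow, Real.norm_eq_abs, sq_abs,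
    real_inner_comm]
  nlinarith [mul_le_mul_of_nonneg_left h (sq_nonneg α)]

theorem Nonexpansive.sq_norm_relax_sub_le (hT : Nonexpansive T) (h0 : 0 ≤ α) (h1 : α ≤ 1) (w : E)
    {z : E} (hz : z ∈ fixedPoints T) : ‖LALHSDM.relax α T w - z‖ ^ 2 ≤
      ‖w - z‖ ^ 2 - α * (1 - α) * ‖w - T w‖ ^ 2 := by
  have h := hT.sq_norm_le_inner_of_mem w hz
  have h2 := hT.sq_norm_relax_sub_le_inner (α := α) w hz
  have h3 : 0 ≤ α * (1 - α) := mul_nonneg h0 (by linarith)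
  nlinarith [mul_le_mul_of_nonneg_left h h3]

theorem Nonexpansive.isAttracting_relax (hT : Nonexpansive T) (hne : (fixedPoints T).Nonempty)
    (h0 : 0 < α) (h1 : α < 1) : IsAttracting (LALHSDM.relax α T) := by
  refine ⟨hT.relax h0.le h1.le, by rwa [fixedPoints_relax h0.ne'], fun w hw z hz => ?_⟩
  rw [fixedPoints_relax h0.ne'] at hw hz
  have h2 := hT.sq_norm_relax_sub_le h0.le h1.le w hz
  have h3 : 0 < ‖w - T w‖ :=
    norm_pos_iff.2 fun h => hw (sub_eq_zero.1 h).symm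
  have h4 : 0 < α * (1 - α) * ‖w - T w‖ ^ 2 := by
    have : 0 < 1 - α := by linarith
    positivity
  exact lt_of_pow_lt_pow_left₀ 2 (norm_nonneg _) (by linarith)

/-- Far from a bounded fixed point set, the displacement has a uniform component in the
direction of a given fixed point. -/
theorem Nonexpansive.exists_mul_norm_le_inner [FiniteDimensional ℝ E] (hT : Nonexpansive T)
    {z : E} {R : ℝ} (hR : 0 < R) (hz : z ∈ fixedPoints T)
    (hfix : ∀ y ∈ fixedPoints T, ‖y - z‖ < R) :
    ∃ ε > 0, ∀ w, R ≤ ‖w - z‖ → ε * ‖w - z‖ ≤ inner ℝ (w - T w) (w - z) := by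
  have := FiniteDimensional.proper ℝ E
  have hTc := hT.continuous
  have hproj : ∀ w, R ≤ ‖w - z‖ → z + (R / ‖w - z‖) • (w - z) ∈ Metric.sphere z R := by
    intro w hw
    have : ‖w - z‖ ≠ 0 := by linarith
    rw [mem_sphere_iff_norm, add_sub_cancel_left, norm_smul, norm_div, norm_norm,
      Real.norm_of_nonneg hR.le, div_mul_cancel₀ _ this]
  -- The sphere is empty when `E` is trivial.
  rcases (Metric.sphere z R).eq_empty_or_nonempty with hS | hS
  · refine ⟨1, one_pos, fun w hw => ?_⟩
    have := hproj w hw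
    simp [hS] at this
  obtain ⟨p, hp, hpmin⟩ := (isCompact_sphere z R).exists_isMinOn hS
    (f := fun w => inner ℝ (w - T w) (w - z)) (by fun_prop)
  have hc : 0 < inner ℝ (p - T p) (p - z) := by
    have h1 := hT.sq_norm_le_inner_of_mem p hz
    have h2 : 0 < ‖p - T p‖ := by
      refine norm_pos_iff.2 fun h => ?_
      have := hfix p (sub_eq_zero.1 h).symm
      rw [mem_sphere_iff_norm.1 hp] at this
      exact lt_irrefl _ this
    nlinarith [pow_pos h2 2]
  set c := inner ℝ (p - T p) (p - z) with hcdef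
  refine ⟨c / R, by positivity, fun w hw => ?_⟩
  have hr : 0 < ‖w - z‖ := by linarith
  set s := R / ‖w - z‖ with hs
  have hs0 : 0 < s := by positivity
  have hs1 : s ≤ 1 := (div_le_one hr).2 hw
  set w' := z + s • (w - z) with hw'
  have hmin : c ≤ inner ℝ (w' - T w') (w' - z) := hpmin (hproj w hw)
  have h1 : w' - z = s • (w - z) := by rw [hw', add_sub_cancel_left]
  rw [h1, inner_smul_right] at hmin
  have hgoal : c / R * ‖w - z‖ = c / s := by rw [hs]; field_simp
  rw [hgoal, div_le_iff₀ hs0]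
  -- Monotonicity of `I - T` carries the bound on the sphere outwards along the ray; it says nothing
  -- when `w' = w`, hence the split.
  rcases hs1.eq_or_lt with hs1 | hs1
  · have h2 : w' = w := by rw [hw', hs1, one_smul, add_sub_cancel]
    rw [h2] at hmin
    linarith
  · have h2 : w - w' = (1 - s) • (w - z) := by rw [hw']; module
    have h3 := (sq_nonneg _).trans (hT.sq_norm_le_inner w w')
    rw [h2, inner_smul_right, inner_sub_left] at h3
    have h4 : 0 ≤ inner ℝ (w - T w) (w - z) - inner ℝ (w' - T w') (w - z) := by
      by_contra! hneg
      nlinarith [mul_pos (sub_pos.2 hs1) (neg_pos.2 hneg)]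
    nlinarith

end Relax

/-! ### Two lemmas on real sequences -/

section Sequences

/-- The growth factors multiply to at most the exponential of the sum of `b`. -/
theorem exists_forall_le_of_le_one_add_mul {c b : ℕ → ℝ} {N : ℕ} (hc : ∀ n, 0 ≤ c n)
    (hb : ∀ n, 0 ≤ b n) (hsum : Summable b) (h : ∀ n ≥ N, c (n + 1) ≤ (1 + b n) * c n) :
    ∃ C, ∀ n ≥ N, c n ≤ C := by
  refine ⟨c N * Real.exp (∑' n, b n), fun n hn => ?_⟩
  have key : c n ≤ c N * Real.exp (∑ k ∈ Finset.range n, b k) := by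
    induction n, hn using Nat.le_induction with
    | base =>
      have : 1 ≤ Real.exp (∑ k ∈ Finset.range N, b k) :=
        Real.one_le_exp (Finset.sum_nonneg fun k _ => hb k)
      nlinarith [hc N]
    | succ n hn ih =>
      rw [Finset.sum_range_succ, Real.exp_add]
      have h1 : 1 + b n ≤ Real.exp (b n) := by linarith [Real.add_one_le_exp (b n)]
      calc c (n + 1) ≤ (1 + b n) * c n := h n hn
        _ ≤ Real.exp (b n) * (c N * Real.exp (∑ k ∈ Finset.range n, b k)) := by
          gcongr
          exact hc n
        _ = _ := by ring
  refine key.trans ?_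
  gcongr
  · exact hc N
  · exact hsum.sum_le_tsum _ fun k _ => hb k

/-- Staying above `δ` forever would make `a` summable. After the first visit below `δ`, a step from
below reaches at most `2 δ` and a step from above does not increase `e`. -/
theorem eventually_le_of_descent {e a : ℕ → ℝ} {N : ℕ} {η δ : ℝ} (he : ∀ n, 0 ≤ e n)
    (ha : ∀ n, 0 ≤ a n) (hsum : ¬ Summable a) (hη : 0 < η)
    (h1 : ∀ n ≥ N, δ ≤ e n → e (n + 1) ≤ e n - η * a n)
    (h2 : ∀ n ≥ N, e n < δ → e (n + 1) ≤ 2 * δ) : ∀ᶠ n in atTop, e n ≤ 2 * δ := by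
  obtain ⟨n₀, hn₀, hlt⟩ : ∃ n ≥ N, e n < δ := by
    by_contra! hcon
    have key : ∀ n, e (n + N) ≤ e N - η * ∑ k ∈ Finset.range n, a (k + N) := by
      intro n
      induction n with
      | zero => simp
      | succ n ih =>
        have := h1 (n + N) (by omega) (hcon _ (by omega))
        rw [Finset.sum_range_succ, add_right_comm]
        linarith
    refine hsum ((summable_nat_add_iff N).1 ?_)
    refine summable_of_sum_range_le (c := e N / η) (fun n => ha _) fun n => ?_
    rw [le_div_iff₀ hη]
    linarith [key n, he (n + N)]
  have hδ : 0 < δ := (he n₀).trans_lt hlt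
  filter_upwards [eventually_ge_atTop n₀] with n hn
  induction n, hn using Nat.le_induction with
  | base => linarith
  | succ n hn ih =>
    rcases lt_or_ge (e n) δ with h | h
    · exact h2 n (by omega) h
    · have := h1 n (by omega) h
      nlinarith [mul_nonneg hη.le (ha n)]

end Sequences

/-! ### Convergence of the hybrid steepest descent method -/

theorem continuous_of_norm_sub_le {E : Type*} [NormedAddCommGroup E] {G : E → E} {κ : ℝ}
    (hLip : ∀ x y, ‖G x - G y‖ ≤ κ * ‖x - y‖) : Continuous G :=
  (LipschitzWith.of_dist_le' (K := κ) fun x y => by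
    simpa [dist_eq_norm] using hLip x y).continuous

section SteepestDescent

variable {E : Type*} [NormedAddCommGroup E] [InnerProductSpace ℝ E]

theorem HasGateauxGradientAt.add_inner_le {Ψ : E → ℝ} {a x : E}
    (h : HasGateauxGradientAt Ψ a x) (hconv : ConvexOn ℝ univ Ψ) (y : E) :
    Ψ x + inner ℝ a (y - x) ≤ Ψ y := by
  have h1 := hasLineDerivAt_iff_tendsto_slope_zero.1 (h (y - x))
  have h2 : Tendsto (fun t : ℝ => t⁻¹ • (Ψ (x + t • (y - x)) - Ψ x)) (𝓝[>] 0)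
      (𝓝 (inner ℝ a (y - x))) :=
    h1.mono_left (nhdsWithin_mono _ fun t ht => ne_of_gt ht)
  have h3 : inner ℝ a (y - x) ≤ Ψ y - Ψ x := by
    refine le_of_tendsto h2 ?_
    filter_upwards [Ioo_mem_nhdsGT (zero_lt_one' ℝ)] with t ht
    rw [smul_eq_mul, inv_mul_le_iff₀ ht.1]
    have h4 := hconv.2 (mem_univ x) (mem_univ y) (sub_nonneg.2 ht.2.le) ht.1.le (by ring)
    have h5 : (1 - t) • x + t • y = x + t • (y - x) := by module
    rw [h5, smul_eq_mul, smul_eq_mul] at h4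
    linarith
  linarith

variable {Θ : E → ℝ} {G : E → E} {κ : ℝ}

theorem continuous_of_add_inner_le (hsub : ∀ x y, Θ x + inner ℝ (G x) (y - x) ≤ Θ y)
    (hG : Continuous G) : Continuous Θ := by
  refine continuous_iff_continuousAt.2 fun x => ?_
  have h1 : Tendsto (fun y => Θ x + inner ℝ (G x) (y - x)) (𝓝 x) (𝓝 (Θ x)) := by
    have : Continuous fun y => Θ x + inner ℝ (G x) (y - x) := by fun_prop
    simpa using this.tendsto x
  have h2 : Tendsto (fun y => Θ x + inner ℝ (G y) (y - x)) (𝓝 x) (𝓝 (Θ x)) := by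
    have : Continuous fun y => Θ x + inner ℝ (G y) (y - x) := by fun_prop
    simpa using this.tendsto x
  refine tendsto_of_tendsto_of_tendsto_of_le_of_le h1 h2 (fun y => hsub x y) fun y => ?_
  have := hsub y x
  rw [← neg_sub, inner_neg_right] at this
  dsimp only
  linarith

/-- Monotonicity of `G` removes the first-order term in `l`, so the excess factor is quadratic,
hence summable along the step sizes, and `l` need not be small. -/
theorem norm_sub_smul_sub_le (hsub : ∀ x y, Θ x + inner ℝ (G x) (y - x) ≤ Θ y)
    (hLip : ∀ x y, ‖G x - G y‖ ≤ κ * ‖x - y‖) {l : ℝ} (hl : 0 ≤ l) (v z : E) :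
    ‖v - l • G v - z‖ ≤ (1 + κ ^ 2 * l ^ 2) * ‖v - z‖ + l * ‖G z‖ := by
  have hmono : 0 ≤ inner ℝ (v - z) (G v - G z) := by
    have h1 := hsub v z
    have h2 := hsub z v
    rw [← neg_sub, inner_neg_right] at h1
    rw [real_inner_comm, inner_sub_left]
    linarith
  have h1 : ‖(v - z) - l • (G v - G z)‖ ≤ (1 + κ ^ 2 * l ^ 2) * ‖v - z‖ := by
    refine le_of_sq_le_sq ?_ (by positivity)
    rw [norm_sub_sq_real, inner_smul_right, norm_smul, mul_pow, Real.norm_of_nonneg hl]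
    have h2 : ‖G v - G z‖ ^ 2 ≤ (κ * ‖v - z‖) ^ 2 := by gcongr; exact hLip v z
    have h3 := mul_le_mul_of_nonneg_left h2 (sq_nonneg l)
    have h4 := mul_nonneg hl hmono
    have h5 : 0 ≤ κ ^ 2 * l ^ 2 * ‖v - z‖ ^ 2 := by positivity
    have h6 : 0 ≤ (κ ^ 2 * l ^ 2) ^ 2 * ‖v - z‖ ^ 2 := by positivity
    nlinarith
  have h2 : v - l • G v - z = ((v - z) - l • (G v - G z)) - l • G z := by module
  rw [h2]
  refine (norm_sub_le _ _).trans ?_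
  rw [norm_smul l, Real.norm_of_nonneg hl]
  linarith

theorem sq_norm_sub_smul_sub_le (hsub : ∀ x y, Θ x + inner ℝ (G x) (y - x) ≤ Θ y) {l : ℝ}
    (hl : 0 ≤ l) (v z : E) :
    ‖v - l • G v - z‖ ^ 2 ≤ ‖v - z‖ ^ 2 - 2 * l * (Θ v - Θ z) + l ^ 2 * ‖G v‖ ^ 2 := by
  have h1 := hsub v z
  have h2 : v - l • G v - z = (v - z) - l • G v := by abel
  rw [← neg_sub, inner_neg_right, real_inner_comm] at h1
  rw [h2, norm_sub_sq_real, inner_smul_right, norm_smul, mul_pow, Real.norm_of_nonneg hl]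
  nlinarith [mul_le_mul_of_nonneg_left h1 hl]

theorem IsL2NotL1.tendsto_zero {a : ℕ → ℝ} (ha : IsL2NotL1 a) : Tendsto a atTop (𝓝 0) := by
  have h := ha.2.1.tendsto_atTop_zero.sqrt
  simpa [Real.sqrt_sq (ha.1 _)] using h

variable [FiniteDimensional ℝ E] {T : E → E} {α : ℝ} {lam : ℕ → ℝ}

theorem exists_norm_hsdmSeq_sub_le (hT : Nonexpansive T)
    (hbdd : Bornology.IsBounded (fixedPoints T)) (h0 : 0 < α) (h1 : α < 1)
    (hsub : ∀ x y, Θ x + inner ℝ (G x) (y - x) ≤ Θ y)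
    (hLip : ∀ x y, ‖G x - G y‖ ≤ κ * ‖x - y‖) (hlam : IsL2NotL1 fun n => lam (n + 1)) (w₀ : E)
    {z : E} (hz : z ∈ fixedPoints T) :
    ∃ (N : ℕ) (C : ℝ), ∀ n ≥ N, ‖hsdmSeq (relax α T) G lam w₀ n - z‖ ≤ C := by
  obtain ⟨R₀, hR₀⟩ := hbdd.exists_norm_le
  set R := R₀ + ‖z‖ + 1 with hR
  have hR₀z := hR₀ z hz
  have hRpos : 0 < R := by linarith [norm_nonneg z]
  obtain ⟨ε, hε, hfar⟩ := hT.exists_mul_norm_le_inner (z := z) hRpos hz (fun y hy => by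
    have := norm_sub_le y z
    have := hR₀ y hy
    linarith)
  have h1' : 0 < 1 - α := by linarith
  set ε' := α * (1 - α) * ε with hε'
  have hε'0 : 0 < ε' := by positivity
  have hsmall : ∀ᶠ n in atTop, lam (n + 1) * ‖G z‖ < ε' := by
    have := hlam.tendsto_zero.mul_const ‖G z‖
    rw [zero_mul] at this
    exact this.eventually_lt_const hε'0
  obtain ⟨N, hN⟩ := eventually_atTop.1 hsmall
  set w := hsdmSeq (relax α T) G lam w₀ with hw
  -- The floor `R + ε'` treats near and far iterates alike: the relaxed step lands `ε'` below this
  -- maximum, and `ε'` pays for `lam (n + 1) * ‖G z‖`.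
  obtain ⟨C, hC⟩ := exists_forall_le_of_le_one_add_mul (c := fun n => max ‖w n - z‖ (R + ε'))
    (b := fun n => κ ^ 2 * lam (n + 1) ^ 2) (N := N)
    (fun n => (norm_nonneg _).trans (le_max_left _ _)) (fun n => by positivity)
    (hlam.2.1.mul_left _) (fun n hn => by
      have hl := hlam.1 n
      have hstep := norm_sub_smul_sub_le hsub hLip hl (relax α T (w n)) z
      have hlG := (hN n hn).le
      have hb : 0 ≤ κ ^ 2 * lam (n + 1) ^ 2 := by positivity
      have hwn : w (n + 1) = relax α T (w n) - lam (n + 1) • G (relax α T (w n)) := rfl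
      rw [← hwn] at hstep
      have hv : ‖relax α T (w n) - z‖ + ε' ≤ max ‖w n - z‖ (R + ε') := by
        rcases le_or_gt R ‖w n - z‖ with h | h
        · refine le_trans ?_ (le_max_left _ _)
          have h2 := hT.sq_norm_relax_sub_le_inner (α := α) (w n) hz
          have h3 : 0 < α * (1 - α) := by positivity
          have h4 := mul_le_mul_of_nonneg_left (hfar (w n) h) h3.le
          have h5 : ‖relax α T (w n) - z‖ ^ 2 ≤ ‖w n - z‖ ^ 2 - 2 * ε' * ‖w n - z‖ := by
            rw [hε']; linarith
          have h6 : 0 < ‖w n - z‖ := by linarith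
          have h7 : 2 * ε' ≤ ‖w n - z‖ := by
            by_contra! hlt
            nlinarith [sq_nonneg ‖relax α T (w n) - z‖]
          have h8 : ‖relax α T (w n) - z‖ ≤ ‖w n - z‖ - ε' := by
            refine le_of_sq_le_sq ?_ (by linarith)
            nlinarith
          linarith
        · refine le_trans ?_ (le_max_right _ _)
          have h2 := hT.sq_norm_relax_sub_le h0.le h1.le (w n) hz
          have h3 : ‖relax α T (w n) - z‖ ≤ ‖w n - z‖ := by
            refine le_of_sq_le_sq (h2.trans ?_) (norm_nonneg _)
            have : 0 ≤ α * (1 - α) * ‖w n - T (w n)‖ ^ 2 := by positivity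
            linarith
          linarith
      have hmax : R + ε' ≤ max ‖w n - z‖ (R + ε') := le_max_right _ _
      refine max_le ?_ ?_
      · refine hstep.trans ?_
        nlinarith [mul_le_mul_of_nonneg_left hv hb, mul_nonneg hb hε'0.le]
      · nlinarith [mul_nonneg hb (hRpos.le.trans (by linarith : R ≤ max ‖w n - z‖ (R + ε')))])
  exact ⟨N, C, fun n hn => (le_max_left _ _).trans (hC n hn)⟩

/-- The hybrid steepest descent method for the averaged nonexpansive operator `relax α T` with
bounded fixed point set approaches the minimizers of `Θ` over the fixed points. -/
theorem tendsto_infDist_hsdmSeq (hT : Nonexpansive T)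
    (hbdd : Bornology.IsBounded (fixedPoints T)) (h0 : 0 < α) (h1 : α < 1)
    (hsub : ∀ x y, Θ x + inner ℝ (G x) (y - x) ≤ Θ y)
    (hLip : ∀ x y, ‖G x - G y‖ ≤ κ * ‖x - y‖) (hlam : IsL2NotL1 fun n => lam (n + 1)) (w₀ : E)
    (hne : (argminOn Θ (fixedPoints T)).Nonempty) :
    Tendsto (fun n => Metric.infDist (hsdmSeq (relax α T) G lam w₀ n)
      (argminOn Θ (fixedPoints T))) atTop (𝓝 0) := by
  have := FiniteDimensional.proper ℝ E
  have hTc := hT.continuous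
  have hSc : Continuous (relax α T) := (hT.relax h0.le h1.le).continuous
  have hGc := continuous_of_norm_sub_le hLip
  have hΘc := continuous_of_add_inner_le hsub hGc
  obtain ⟨z₀, hz₀⟩ := id hne
  obtain ⟨N, C, hC⟩ := exists_norm_hsdmSeq_sub_le hT hbdd h0 h1 hsub hLip hlam w₀ hz₀.1
  set Ω := argminOn Θ (fixedPoints T) with hΩ
  have hΩeq : Ω = {w | T w = w ∧ Θ w ≤ Θ z₀} := by
    ext w
    constructor
    · exact fun hw => ⟨hw.1, hw.2 z₀ hz₀.1⟩
    · exact fun hw => ⟨hw.1, fun y hy => hw.2.trans (hz₀.2 y hy)⟩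
  have hΩcl : IsClosed Ω := by
    rw [hΩeq]
    exact (isClosed_eq hTc continuous_id).inter (isClosed_le hΘc continuous_const)
  have hΩval : ∀ z ∈ Ω, Θ z = Θ z₀ := fun z hz => le_antisymm (hz.2 z₀ hz₀.1) (hz₀.2 z hz.1)
  set w := hsdmSeq (relax α T) G lam w₀ with hw
  set B := Metric.closedBall z₀ C with hB
  have hwB : ∀ n ≥ N, w n ∈ B := fun n hn => mem_closedBall_iff_norm.2 (hC n hn)
  have hBc : IsCompact B := isCompact_closedBall z₀ C
  obtain ⟨Mg, hMg⟩ := hBc.exists_bound_of_continuousOn (f := fun w => G (relax α T w))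
    (by fun_prop)
  obtain ⟨Mt, hMt⟩ := hBc.exists_bound_of_continuousOn
    (f := fun w => Θ (relax α T w) - Θ z₀) (by fun_prop)
  have hc : 0 < α * (1 - α) := mul_pos h0 (by linarith)
  set c := α * (1 - α) with hcdef
  set d := fun n => Metric.infDist (w n) Ω with hd
  have hd0 : ∀ n, 0 ≤ d n := fun n => Metric.infDist_nonneg
  -- Both step estimates are taken at the point of `Ω` nearest to `w n`.
  have hdesc : ∀ n, d (n + 1) ^ 2 ≤ d n ^ 2 - c * ‖w n - T (w n)‖ ^ 2 -
      2 * lam (n + 1) * (Θ (relax α T (w n)) - Θ z₀) +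
      lam (n + 1) ^ 2 * ‖G (relax α T (w n))‖ ^ 2 := by
    intro n
    obtain ⟨z, hz, hdz⟩ := hΩcl.exists_infDist_eq_dist hne (w n)
    have h2 : d (n + 1) ≤ ‖w (n + 1) - z‖ := by
      rw [← dist_eq_norm]; exact Metric.infDist_le_dist_of_mem hz
    have h3 := sq_norm_sub_smul_sub_le hsub (hlam.1 n) (relax α T (w n)) z
    have h4 := hT.sq_norm_relax_sub_le h0.le h1.le (w n) hz.1
    have h5 : d n = ‖w n - z‖ := by rw [← dist_eq_norm]; exact hdz
    have h6 : d (n + 1) ^ 2 ≤ ‖w (n + 1) - z‖ ^ 2 := by gcongr; exact hd0 _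
    have hwn : w (n + 1) = relax α T (w n) - lam (n + 1) • G (relax α T (w n)) := rfl
    rw [← hwn, hΩval z hz] at h3
    rw [h5]
    linarith
  have hlim : ∀ ε > 0, ∀ᶠ n in atTop, d n ^ 2 ≤ 2 * ε ^ 2 := by
    intro ε hε
    -- By compactness: a point where the maximum is nonpositive is fixed with `Θ` at most optimal,
    -- so it lies in `Ω`.
    obtain ⟨η, hη, hgap⟩ : ∃ η > 0, ∀ v ∈ B, ε ≤ Metric.infDist v Ω →
        η ≤ max ‖v - T v‖ (Θ (relax α T v) - Θ z₀) := by
      set S := B ∩ {v | ε ≤ Metric.infDist v Ω} with hS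
      have hSc' : IsCompact S :=
        hBc.inter_right (isClosed_le continuous_const (Metric.continuous_infDist_pt Ω))
      rcases S.eq_empty_or_nonempty with hSe | hSne
      · refine ⟨1, one_pos, fun v hv hv' => ?_⟩
        have : v ∈ S := ⟨hv, hv'⟩
        simp [hSe] at this
      obtain ⟨p, hp, hpmin⟩ := hSc'.exists_isMinOn hSne
        (f := fun v => max ‖v - T v‖ (Θ (relax α T v) - Θ z₀)) (by fun_prop)
      refine ⟨max ‖p - T p‖ (Θ (relax α T p) - Θ z₀), ?_, fun v hv hv' => hpmin ⟨hv, hv'⟩⟩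
      by_contra! hle
      have h2 : T p = p := by
        have := norm_le_zero_iff.1 ((le_max_left _ _).trans hle)
        exact (sub_eq_zero.1 this).symm
      have h3 : relax α T p = p := by
        have : p ∈ fixedPoints (relax α T) := by rw [fixedPoints_relax h0.ne']; exact h2
        exact this
      have h4 := (le_max_right _ _).trans hle
      rw [h3] at h4
      have h5 : p ∈ Ω := by rw [hΩeq]; exact ⟨h2, by linarith⟩
      have h6 : ε ≤ Metric.infDist p Ω := hp.2
      rw [Metric.infDist_zero_of_mem h5] at h6
      linarith
    have hpert : Tendsto (fun n => 2 * lam (n + 1) * Mt + lam (n + 1) ^ 2 * Mg ^ 2 +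
        η * lam (n + 1)) atTop (𝓝 0) := by
      have hl := hlam.tendsto_zero
      have := (((hl.const_mul 2).mul_const Mt).add ((hl.pow 2).mul_const (Mg ^ 2))).add
        (hl.const_mul η)
      simpa using this
    have hlMg : Tendsto (fun n => lam (n + 1) * Mg ^ 2) atTop (𝓝 0) := by
      simpa using hlam.tendsto_zero.mul_const (Mg ^ 2)
    obtain ⟨N', hN'⟩ := eventually_atTop.1
      ((hpert.eventually_lt_const (show 0 < min (c * η ^ 2) (ε ^ 2) by positivity)).and
        (hlMg.eventually_lt_const hη))
    have hbasic : ∀ n ≥ N, lam (n + 1) ^ 2 * ‖G (relax α T (w n))‖ ^ 2 ≤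
        lam (n + 1) ^ 2 * Mg ^ 2 ∧
        -(2 * lam (n + 1) * (Θ (relax α T (w n)) - Θ z₀)) ≤ 2 * lam (n + 1) * Mt := by
      intro n hn
      have hl := hlam.1 n
      refine ⟨by gcongr; exact hMg _ (hwB n hn), ?_⟩
      have h2 := (abs_le.1 (hMt _ (hwB n hn))).1
      nlinarith
    refine eventually_le_of_descent (e := fun n => d n ^ 2) (a := fun n => lam (n + 1))
      (N := max N N') (η := η) (δ := ε ^ 2) (fun n => sq_nonneg _) hlam.1 hlam.2.2 hη ?_ ?_
    · intro n hn hge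
      have hl := hlam.1 n
      have hdn : ε ≤ d n := le_of_sq_le_sq hge (hd0 n)
      obtain ⟨hb1, hb2⟩ := hbasic n ((le_max_left _ _).trans hn)
      obtain ⟨hp1, hp2⟩ := hN' n ((le_max_right _ _).trans hn)
      have hp1' := hp1.trans_le (min_le_left _ _)
      have hdn1 := hdesc n
      -- A large displacement drops by `c η²`, which beats all perturbations and `η λ`; a large gap
      -- drops by `2 η λ`, of which the gradient term consumes at most `η λ`.
      rcases le_max_iff.1 (hgap _ (hwB n ((le_max_left _ _).trans hn)) hdn) with h | h
      · have h2 : c * η ^ 2 ≤ c * ‖w n - T (w n)‖ ^ 2 := by gcongr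
        linarith
      · have h2 : 0 ≤ c * ‖w n - T (w n)‖ ^ 2 := by positivity
        have h3 := mul_le_mul_of_nonneg_left h hl
        have h4 := mul_le_mul_of_nonneg_left hp2.le hl
        nlinarith
    · intro n hn hlt
      have hl := hlam.1 n
      obtain ⟨hb1, hb2⟩ := hbasic n ((le_max_left _ _).trans hn)
      have hp1 := (hN' n ((le_max_right _ _).trans hn)).1.trans_le (min_le_right _ _)
      have hdn1 := hdesc n
      have h2 : 0 ≤ c * ‖w n - T (w n)‖ ^ 2 := by positivity
      have h3 := mul_nonneg hη.le hl
      linarith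
  rw [Metric.tendsto_atTop]
  intro ε hε
  obtain ⟨n₀, hn₀⟩ := eventually_atTop.1 (hlim (ε / 2) (by linarith))
  refine ⟨n₀, fun n hn => ?_⟩
  rw [Real.dist_0_eq_abs, abs_of_nonneg (hd0 n)]
  refine lt_of_pow_lt_pow_left₀ 2 hε.le ((hn₀ n hn).trans_lt ?_)
  nlinarith

end SteepestDescent

/-! ### Coordinates on the product space -/

section Components

variable {X K : Type*}

@[simp] theorem xOf_triple (x : X) (y ν : K) : xOf (triple x y ν) = x := rfl

@[simp] theorem yOf_triple (x : X) (y ν : K) : yOf (triple x y ν) = y := rfl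

@[simp] theorem nuOf_triple (x : X) (y ν : K) : nuOf (triple x y ν) = ν := rfl

theorem triple_eta (w : Triple X K) : triple (xOf w) (yOf w) (nuOf w) = w := rfl

theorem triple_eq_iff {x : X} {y ν : K} {w : Triple X K} :
    triple x y ν = w ↔ x = xOf w ∧ y = yOf w ∧ ν = nuOf w :=
  ⟨fun h => h ▸ ⟨rfl, rfl, rfl⟩, fun ⟨h1, h2, h3⟩ => by rw [h1, h2, h3, triple_eta]⟩

variable [NormedAddCommGroup X] [NormedAddCommGroup K]

theorem triple_sub (x x' : X) (y y' ν ν' : K) :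
    triple x y ν - triple x' y' ν' = triple (x - x') (y - y') (ν - ν') := rfl

theorem norm_triple_sq (x : X) (y ν : K) :
    ‖triple x y ν‖ ^ 2 = ‖x‖ ^ 2 + ‖y‖ ^ 2 + ‖ν‖ ^ 2 := by
  rw [WithLp.prod_norm_sq_eq_of_L2, WithLp.prod_norm_sq_eq_of_L2]
  rfl

variable [InnerProductSpace ℝ X] [InnerProductSpace ℝ K]

theorem Xi_apply (w : Triple X K) : Xi X K w = xOf w := rfl

theorem norm_Xi_le : ‖Xi X K‖ ≤ 1 := by
  refine ContinuousLinearMap.opNorm_le_bound _ zero_le_one fun w => ?_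
  rw [one_mul, Xi_apply, ← triple_eta w]
  refine le_of_sq_le_sq ?_ (norm_nonneg _)
  rw [norm_triple_sq, xOf_triple]
  nlinarith [sq_nonneg ‖yOf w‖, sq_nonneg ‖nuOf w‖]

theorem Xi_adjoint_apply [CompleteSpace X] [CompleteSpace K] (a : X) :
    (Xi X K).adjoint a = triple a 0 0 := by
  refine ext_inner_right ℝ fun w => ?_
  rw [ContinuousLinearMap.adjoint_inner_left, WithLp.prod_inner_apply, WithLp.prod_inner_apply]
  change inner ℝ a (xOf w) = inner ℝ a (xOf w) + inner ℝ (0 : K) _ + inner ℝ (0 : K) _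
  rw [inner_zero_left, inner_zero_left, add_zero, add_zero]

theorem sq_norm_smul_checkA_le {A : X →L[ℝ] K} {u : ℝ} (hu : 0 < u)
    (hA : ‖checkA A‖ ≤ 1 / u) (x : X) (y : K) :
    ‖u • (A x - y)‖ ^ 2 ≤ ‖x‖ ^ 2 + ‖y‖ ^ 2 := by
  have h1 := (checkA A).le_of_opNorm_le hA (WithLp.toLp 2 (x, y))
  have h2 : ‖(WithLp.toLp 2 (x, y) : WithLp 2 (X × K))‖ ^ 2 = ‖x‖ ^ 2 + ‖y‖ ^ 2 := by
    rw [WithLp.prod_norm_sq_eq_of_L2]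
    rfl
  rw [← h2]
  have h3 : ‖u • (A x - y)‖ ≤ ‖(WithLp.toLp 2 (x, y) : WithLp 2 (X × K))‖ := by
    rw [norm_smul, Real.norm_of_nonneg hu.le]
    calc u * ‖A x - y‖ ≤ u * (1 / u * ‖(WithLp.toLp 2 (x, y) : WithLp 2 (X × K))‖) := by
          gcongr
          exact h1
      _ = _ := by field_simp
  gcongr

end Components

/-! ### Nonexpansiveness and fixed points of the LAL operator -/

section Operator

variable {X K : Type*} [NormedAddCommGroup X] [InnerProductSpace ℝ X] [CompleteSpace X]
  [NormedAddCommGroup K] [InnerProductSpace ℝ K] [CompleteSpace K]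
  {f : X → EReal} {g : K → EReal} {A : X →L[ℝ] K} {u : ℝ}

/-- The estimate behind the nonexpansiveness of the linearized augmented Lagrangian operator: `a`,
`b`, `n` are differences of inputs, `p`, `q` those of the proximal points. -/
theorem norm_sq_le_of_inner_nonneg (hu : 0 < u) (hA : ‖checkA A‖ ≤ 1 / u) {a p : X} {b q n : K}
    (hx : 0 ≤ inner ℝ (a - u ^ 2 • (A.adjoint (A a) - A.adjoint b) + u • A.adjoint n - p) p)
    (hy : 0 ≤ inner ℝ (b - u ^ 2 • (-A a + b) - u • n - q) q) :
    ‖p‖ ^ 2 + ‖q‖ ^ 2 + ‖n - u • (A p - q)‖ ^ 2 ≤ ‖a‖ ^ 2 + ‖b‖ ^ 2 + ‖n‖ ^ 2 := by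
  -- Adding this to twice `hx` and `hy` cancels every cross term between inputs and outputs except
  -- the one in `n`; the leftover `u² ‖A a - b‖²` has a favourable sign.
  have h := sq_norm_smul_checkA_le hu hA (a - p) (b - q)
  rw [map_sub, show A a - A p - (b - q) = (A a - b) - (A p - q) by abel] at h
  have h0 : 0 ≤ u ^ 2 * ‖A a - b‖ ^ 2 := by positivity
  simp only [inner_sub_left, inner_add_left, real_inner_smul_left, inner_neg_left,
    ContinuousLinearMap.adjoint_inner_left, real_inner_self_eq_norm_sq] at hx hy
  simp only [norm_smul, mul_pow, norm_sub_sq_real, Real.norm_eq_abs, sq_abs, inner_sub_left,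
    inner_sub_right, real_inner_smul_right] at h h0 ⊢
  linarith

theorem nonexpansive_lalOp (hf : IsGamma0 f) (hg : IsGamma0 g) (hu : 0 < u)
    (hA : ‖checkA A‖ ≤ 1 / u) : Nonexpansive (lalOp f g A u) := by
  intro w w'
  have hx : ∀ v : Triple X K, IsSubgradientAt f
      (xOf v - u ^ 2 • (A.adjoint (A (xOf v)) - A.adjoint (yOf v)) + u • A.adjoint (nuOf v) -
        lalX f A u (xOf v) (yOf v) (nuOf v)) (lalX f A u (xOf v) (yOf v) (nuOf v)) :=
    fun v => hf.isProx_iff_isSubgradientAt.1 (hf.isProx_prox _)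
  have hy : ∀ v : Triple X K, IsSubgradientAt g
      (yOf v - u ^ 2 • (-A (xOf v) + yOf v) - u • nuOf v - lalY g A u (xOf v) (yOf v) (nuOf v))
      (lalY g A u (xOf v) (yOf v) (nuOf v)) :=
    fun v => hg.isProx_iff_isSubgradientAt.1 (hg.isProx_prox _)
  refine le_of_sq_le_sq ?_ (norm_nonneg _)
  rw [lalOp, lalOp, triple_sub, norm_triple_sq, lalNu, lalNu]
  conv_rhs => rw [← triple_eta w, ← triple_eta w', triple_sub, norm_triple_sq]
  have key := norm_sq_le_of_inner_nonneg (n := nuOf w - nuOf w') hu hA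
    (a := xOf w - xOf w') (b := yOf w - yOf w')
    (p := lalX f A u (xOf w) (yOf w) (nuOf w) - lalX f A u (xOf w') (yOf w') (nuOf w'))
    (q := lalY g A u (xOf w) (yOf w) (nuOf w) - lalY g A u (xOf w') (yOf w') (nuOf w'))
    (by
      refine ((hx w).inner_nonneg (hx w')).trans_eq ?_
      congr 1
      simp only [map_sub]
      module)
    (by
      refine ((hy w).inner_nonneg (hy w')).trans_eq ?_
      congr 1
      simp only [map_sub]
      module)
  refine le_trans (le_of_eq ?_) key
  congr 3
  simp only [map_sub]
  module

/-- Once `A x = y`, the linearized penalty terms vanish from both proximal arguments. -/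
theorem mem_fixedPoints_lalOp_iff (hf : IsGamma0 f) (hg : IsGamma0 g) (hu : 0 < u)
    {w : Triple X K} : w ∈ fixedPoints (lalOp f g A u) ↔
      A (xOf w) = yOf w ∧ IsSubgradientAt f (u • A.adjoint (nuOf w)) (xOf w) ∧
        IsSubgradientAt g (-(u • nuOf w)) (yOf w) := by
  have hsub : A (xOf w) = yOf w →
      (xOf w - u ^ 2 • (A.adjoint (A (xOf w)) - A.adjoint (yOf w)) +
        u • A.adjoint (nuOf w)) - xOf w = u • A.adjoint (nuOf w) ∧
      (yOf w - u ^ 2 • (-(A (xOf w)) + yOf w) - u • nuOf w) - yOf w = -(u • nuOf w) := by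
    intro h
    rw [h]
    constructor <;> module
  rw [mem_fixedPoints_iff, lalOp, triple_eq_iff]
  constructor
  · rintro ⟨hx, hy, hν⟩
    have h : A (xOf w) = yOf w := by
      rw [lalNu, hx, hy, sub_eq_self, smul_eq_zero_iff_right hu.ne', sub_eq_zero] at hν
      exact hν
    obtain ⟨e1, e2⟩ := hsub h
    rw [lalX, hf.prox_eq_iff, e1] at hx
    rw [lalY, hg.prox_eq_iff, e2] at hy
    exact ⟨h, hx, hy⟩
  · rintro ⟨h, hx, hy⟩
    obtain ⟨e1, e2⟩ := hsub h
    rw [← e1, ← hf.prox_eq_iff] at hx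
    rw [← e2, ← hg.prox_eq_iff] at hy
    refine ⟨hx, hy, ?_⟩
    rw [lalNu, lalX, hx, lalY, hy, h, sub_self, smul_zero, sub_zero]

theorem Xi_image_fixedPoints_lalOp (hf : IsGamma0 f) (hg : IsGamma0 g) (hq : Qualified f g A)
    (hu : 0 < u) : Xi X K '' fixedPoints (lalOp f g A u) = primalSol f g A := by
  ext x
  rw [hq.mem_primalSol_iff_exists hf hg]
  constructor
  · rintro ⟨w, hw, rfl⟩
    obtain ⟨h1, h2, h3⟩ := (mem_fixedPoints_lalOp_iff hf hg hu).1 hw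
    -- The third component is the multiplier up to the scaling `φ = -u ν`.
    refine ⟨-(u • nuOf w), ?_, ?_⟩
    · rwa [map_neg, map_smul, neg_neg]
    · rwa [Xi_apply, h1]
  · rintro ⟨φ, h1, h2⟩
    refine ⟨triple x (A x) (-(u⁻¹ • φ)), (mem_fixedPoints_lalOp_iff hf hg hu).2 ⟨rfl, ?_, ?_⟩, rfl⟩
    · simpa [smul_smul, hu.ne'] using h1
    · simpa [smul_smul, hu.ne'] using h2

end Operator

/-! ### The lifted objective and the algorithm as steepest descent -/

section Objective

variable {X K : Type*} [NormedAddCommGroup X] [InnerProductSpace ℝ X]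
  [NormedAddCommGroup K] [InnerProductSpace ℝ K] {Ψ : X → ℝ} {gradΨ : X → X}

theorem IsGamma0.comp_Xi {h : X → EReal} (hh : IsGamma0 h) :
    IsGamma0 fun w : Triple X K => h (Xi X K w) where
  ne_bot w := hh.ne_bot _
  proper := by
    obtain ⟨x, hx⟩ := hh.proper
    exact ⟨triple x 0 0, hx⟩
  lsc := hh.lsc.comp (Xi X K).continuous
  convex w hw w' hw' t h0 h1 := by
    rw [map_add, map_smul, map_smul]
    exact hh.convex _ hw _ hw' t h0 h1

theorem IsGamma0.convexOn_univ (hΨ : IsGamma0 fun x => (Ψ x : EReal)) : ConvexOn ℝ univ Ψ := by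
  have h : effDom (fun x => (Ψ x : EReal)) = univ := eq_univ_of_forall fun x => EReal.coe_lt_top _
  simpa [h] using hΨ.convexOn

theorem argminOn_comp_image {α β γ : Type*} [LE γ] (F : β → γ) (π : α → β) (S : Set α) :
    argminOn (fun w => F (π w)) S = S ∩ π ⁻¹' argminOn F (π '' S) := by
  ext w
  simp only [argminOn, mem_ofPred_eq, mem_inter_iff, mem_preimage, forall_mem_image]
  exact ⟨fun h => ⟨h.1, mem_image_of_mem π h.1, h.2⟩, fun h => ⟨h.1, h.2.2⟩⟩

theorem image_argminOn_comp {α β γ : Type*} [LE γ] (F : β → γ) (π : α → β) (S : Set α) :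
    π '' argminOn (fun w => F (π w)) S = argminOn F (π '' S) := by
  rw [argminOn_comp_image, image_inter_preimage]
  exact inter_eq_right.2 fun x hx => hx.1

theorem HasGateauxGradientAt.comp_Xi [CompleteSpace X] [CompleteSpace K] {w : Triple X K} {a : X}
    (h : HasGateauxGradientAt Ψ a (Xi X K w)) :
    HasGateauxGradientAt (fun w => Ψ (Xi X K w)) ((Xi X K).adjoint a) w := by
  intro d
  have h1 := h (Xi X K d)
  rw [ContinuousLinearMap.adjoint_inner_left]
  simpa only [HasLineDerivAt, map_add, map_smul] using h1

theorem norm_Xi_adjoint_sub_le [CompleteSpace X] [CompleteSpace K] {κ : ℝ} (hκ : 0 ≤ κ)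
    (hLip : ∀ x y, ‖gradΨ x - gradΨ y‖ ≤ κ * ‖x - y‖) (w w' : Triple X K) :
    ‖(Xi X K).adjoint (gradΨ (Xi X K w)) - (Xi X K).adjoint (gradΨ (Xi X K w'))‖
      ≤ κ * ‖w - w'‖ := by
  have h1 : ‖(Xi X K).adjoint‖ ≤ 1 := by
    rw [LinearIsometryEquiv.norm_map]; exact norm_Xi_le
  have h2 := (Xi X K).le_of_opNorm_le norm_Xi_le (w - w')
  rw [← map_sub]
  calc _ ≤ 1 * ‖gradΨ (Xi X K w) - gradΨ (Xi X K w')‖ :=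
        ContinuousLinearMap.le_of_opNorm_le _ h1 _
    _ ≤ κ * ‖Xi X K (w - w')‖ := by rw [one_mul, map_sub]; exact hLip _ _
    _ ≤ κ * ‖w - w'‖ := by gcongr; rwa [one_mul] at h2

theorem lalSeq_eq_hsdmSeq [CompleteSpace X] [CompleteSpace K] (f : X → EReal) (g : K → EReal)
    (A : X →L[ℝ] K) (u : ℝ) (gradΨ : X → X) (α : ℝ) (lam : ℕ → ℝ) (w₀ : Triple X K) :
    lalSeq f g A u gradΨ α lam w₀ = hsdmSeq (relax α (lalOp f g A u))
      (fun w => (Xi X K).adjoint (gradΨ (Xi X K w))) lam w₀ := by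
  funext n
  induction n with
  | zero => rfl
  | succ n ih =>
    rw [lalSeq, hsdmSeq, ih, Xi_adjoint_apply]
    -- The lifted gradient has zero second and third components, so only `x` is corrected.
    change triple _ _ _ = relax α (lalOp f g A u) _ - triple _ (lam (n + 1) • 0) (lam (n + 1) • 0)
    rw [smul_zero, ← triple_eta (relax α (lalOp f g A u) _), triple_sub, sub_zero, sub_zero]
    rfl

end Objective

end LALHSDM

end

/-! ### Assembly of the theorem -/

open LALHSDM in
theorem theorem4 {X K : Type*}
    [NormedAddCommGroup X] [InnerProductSpace ℝ X] [CompleteSpace X]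
    [NormedAddCommGroup K] [InnerProductSpace ℝ K] [CompleteSpace K]
    (f : X → EReal) (g : K → EReal) (A : X →L[ℝ] K) (u : ℝ)
    (Ψ : X → ℝ) (gradΨ : X → X)
    (hf : IsGamma0 f) (hg : IsGamma0 g)
    (hS : (primalSol f g A).Nonempty)
    (hq : Qualified f g A)
    (hu : 0 < u) (hA : ‖checkA A‖ ≤ 1 / u)
    (hΨ : IsGamma0 (fun x => (Ψ x : EReal)))
    (hgrad : ∀ x, HasGateauxGradientAt Ψ (gradΨ x) x)
    (hLip : ∃ κ : ℝ, 0 < κ ∧ ∀ x y, ‖gradΨ x - gradΨ y‖ ≤ κ * ‖x - y‖)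
    (hΩ : (hierSol f g A Ψ).Nonempty) :
    -- the proximity operators, hence the LAL operator, are well defined
    (∀ x, (∃! p, IsProx f x p) ∧ IsProx f x (prox f x)) ∧
    (∀ y, (∃! q, IsProx g y q) ∧ IsProx g y (prox g y)) ∧
    -- the LAL operator is nonexpansive
    Nonexpansive (lalOp f g A u) ∧
    -- `Θ = Ψ ∘ Ξ` belongs to `Γ₀` and has the Lipschitzian gradient `Ξ* ∘ ∇Ψ ∘ Ξ`
    IsGamma0 (fun w : Triple X K => (Ψ (Xi X K w) : EReal)) ∧
    (∀ w : Triple X K, HasGateauxGradientAt (fun w => Ψ (Xi X K w))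
      ((Xi X K).adjoint (gradΨ (Xi X K w))) w) ∧
    (∃ κ : ℝ, 0 < κ ∧ ∀ w w' : Triple X K,
      ‖(Xi X K).adjoint (gradΨ (Xi X K w)) - (Xi X K).adjoint (gradΨ (Xi X K w'))‖
        ≤ κ * ‖w - w'‖) ∧
    ∀ α : ℝ, 0 < α → α < 1 →
      -- the relaxed operator is attracting, and its fixed points describe both problems
      IsAttracting (relax α (lalOp f g A u)) ∧
      Function.fixedPoints (relax α (lalOp f g A u)) = Function.fixedPoints (lalOp f g A u) ∧
      Xi X K '' Function.fixedPoints (relax α (lalOp f g A u)) = primalSol f g A ∧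
      (argminOn (fun w => Ψ (Xi X K w))
        (Function.fixedPoints (relax α (lalOp f g A u)))).Nonempty ∧
      Xi X K '' argminOn (fun w => Ψ (Xi X K w))
        (Function.fixedPoints (relax α (lalOp f g A u))) = hierSol f g A Ψ ∧
      ∀ lam : ℕ → ℝ, IsL2NotL1 (fun n => lam (n + 1)) →
        ∀ w₀ : Triple X K,
          -- the algorithm is the hybrid steepest descent method for these data
          lalSeq f g A u gradΨ α lam w₀ =
            hsdmSeq (relax α (lalOp f g A u))
              (fun w => (Xi X K).adjoint (gradΨ (Xi X K w))) lam w₀ ∧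
          -- convergence in finite dimensions
          (FiniteDimensional ℝ (Triple X K) →
            Bornology.IsBounded (Function.fixedPoints (lalOp f g A u)) →
            Filter.Tendsto
              (fun n => Metric.infDist (xOf (lalSeq f g A u gradΨ α lam w₀ n))
                (hierSol f g A Ψ))
              Filter.atTop (nhds 0)) := by
  obtain ⟨κ, hκ, hLip⟩ := hLip
  have hT := nonexpansive_lalOp hf hg hu hA
  have hfix := Xi_image_fixedPoints_lalOp hf hg hq hu
  have hne : (Function.fixedPoints (lalOp f g A u)).Nonempty := by
    rw [← Set.image_nonempty (f := Xi X K), hfix]; exact hS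
  have hΘ : IsGamma0 (fun w : Triple X K => (Ψ (Xi X K w) : EReal)) := hΨ.comp_Xi
  have hΘgrad : ∀ w : Triple X K, HasGateauxGradientAt (fun w => Ψ (Xi X K w))
      ((Xi X K).adjoint (gradΨ (Xi X K w))) w := fun w => (hgrad _).comp_Xi
  have hΘLip := norm_Xi_adjoint_sub_le (K := K) hκ.le hLip
  have himage : Xi X K '' argminOn (fun w => Ψ (Xi X K w))
      (Function.fixedPoints (lalOp f g A u)) = hierSol f g A Ψ := by
    rw [image_argminOn_comp, hfix, hierSol]
  have hΩne : (argminOn (fun w => Ψ (Xi X K w))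
      (Function.fixedPoints (lalOp f g A u))).Nonempty := by
    rw [← Set.image_nonempty (f := Xi X K), himage]; exact hΩ
  refine ⟨fun x => ⟨⟨_, hf.isProx_prox x, fun p hp => hf.isProx_unique hp (hf.isProx_prox x)⟩,
      hf.isProx_prox x⟩,
    fun y => ⟨⟨_, hg.isProx_prox y, fun p hp => hg.isProx_unique hp (hg.isProx_prox y)⟩,
      hg.isProx_prox y⟩, hT, hΘ, hΘgrad, ⟨κ, hκ, hΘLip⟩, fun α h0 h1 => ?_⟩
  rw [fixedPoints_relax h0.ne']
  refine ⟨hT.isAttracting_relax hne h0 h1, rfl, hfix, hΩne, himage, fun lam hlam w₀ =>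
    ⟨lalSeq_eq_hsdmSeq f g A u gradΨ α lam w₀, fun _ hbdd => ?_⟩⟩
  rw [lalSeq_eq_hsdmSeq]
  have hlim := tendsto_infDist_hsdmSeq hT hbdd h0 h1
    (fun w w' => (hΘgrad w).add_inner_le hΘ.convexOn_univ w') hΘLip hlam w₀ hΩne
  refine squeeze_zero (fun n => Metric.infDist_nonneg) (fun n => ?_) hlim
  -- Lifted minimizers project into the hierarchical solution set and `Ξ` does not increase
  -- distances, so the distance in `X` is dominated by that in the product.
  refine (Metric.le_infDist hΩne).2 fun z hz => ?_
  have hz' : Xi X K z ∈ hierSol f g A Ψ := himage ▸ Set.mem_image_of_mem _ hz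
  refine (Metric.infDist_le_dist_of_mem hz').trans ?_
  have h2 := (Xi X K).le_of_opNorm_le norm_Xi_le
    (hsdmSeq (relax α (lalOp f g A u)) (fun w => (Xi X K).adjoint (gradΨ (Xi X K w))) lam w₀ n - z)
  rwa [one_mul, map_sub, ← dist_eq_norm, ← dist_eq_norm] at h2
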